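/- Let $H=(V,\mathcal E)$ be a simple $k$-uniform hypergraph (any two distinct hyperedges share at most one vertex) on $n$ vertices, labelled $0,1,\dots,n-1$, with maximum degree $\Delta\ge 1$. Let $q$ be a positive integer, $s=\lceil\sqrt q\,\rceil$, and let $h:[q]\to[s]$ be a balanced projection scheme, i.e. $|h^{-1}(j)|\in\{\lfloor q/s\rfloor,\lceil q/s\rceil\}$ for every $j\in[s]$. Let $\mu$ be the uniform distribution on the proper $q$-colourings of $H$ (no hyperedge is monochromatic), and let the projected distribution $\nu$ on $[s]^V$ be the law of $(h(X_v))_{v\in V}$ for $X\sim\mu$. The idealised systematic scan $\boldsymbol P_{scan}$ for $\nu$ starts at an arbitrary $X_0\in[s]^V$; in step $t=1,2,\dots$ it takes the vertex $v$ with label $t \bmod n$, keeps $X_t(u)=X_{t-1}(u)$ for all $u\ne v$, and samples $X_t(v)$ from the conditional law, under $\nu$, of the value at $v$ given that the other values are $X_{t-1}(V\setminus\{v\})$. For times $r\le r'$ let $P_{r,r'}$ be the matrix of transition probabilities from time $r$ to time $r'$, and put $P^t=P_{0,t}$. For $\epsilon>0$ let $T_{\mathrm{mix}}(\boldsymbol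 P_{scan},\epsilon)=\min\{t : \max_{X\in[s]^V} d_{TV}(P^t(X,\cdot),\nu)<\epsilon\}$. Suppose that $k\ge 20$ and $q\ge 40\,\Delta^{2/(k-4)}$. Then $\nu$ is a well-defined probability distribution with $\nu(\tau)>0$ for all $\tau\in[s]^V$ (so all the conditional laws above are defined), and: 1. (irreducible) for every time $r\ge 0$ and all $X,Y\in[s]^V$ there is $t>0$ with $P_{r,r+t}(X,Y)>0$; 2. (aperiodic) for every time $r\ge 0$ and every $X\in[s]^V$, $\gcd\{t : P_{r,r+t}(X,X)>0\}=1$; 3. (reversible) for every $t\ge 1$, the transition matrix $P_{t-1,t}$ of the $t$-th step satisfies the detailed balance condition $\nu(X)P_{t-1,t}(X,Y)=\nu(Y)P_{t-1,t}(Y,X)$ for all $X,Y\in[s]^V$; 4. the time-homogeneous chain whose transition matrix is that of one full sweep, $P^{n}$, is also irreducible and aperiodic; 5. for all $0<\epsilon<1$, with $\log$ the natural logarithm, $$T_{\mathrm{mix}}(\boldsymbol P_{scan},\epsilon)\le\Bigl\lceil 50\,n\log\frac{n\Delta}{\epsilon}\Bigr\rceil .$$ -/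

import Mathlib

open scoped Hypergraph

namespace Hypergraph

variable {V : Type*}

/-- Every hyperedge has exactly `k` vertices. -/
def IsUniform (H : Hypergraph V) (k : ℕ) : Prop :=
  ∀ e ∈ E(H), e.ncard = k

/-- A hypergraph is simple (linear) if two different hyperedges share at most one vertex. -/
def IsSimple (H : Hypergraph V) : Prop :=
  ∀ e ∈ E(H), ∀ f ∈ E(H), e ≠ f → (e ∩ f).ncard ≤ 1

/-- The degree of a vertex: the number of hyperedges that contain it. -/
noncomputable def degree (H : Hypergraph V) (v : V) : ℕ :=
  {e | e ∈ E(H) ∧ v ∈ e}.ncard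

/-- The maximum degree of a hypergraph on a finite vertex type. -/
noncomputable def maxDegree (H : Hypergraph V) [Fintype V] : ℕ :=
  Finset.univ.sup fun v => H.degree v

/-- A colouring is proper if no hyperedge is monochromatic. -/
def IsProper (H : Hypergraph V) {C : Type*} (X : V → C) : Prop :=
  ∀ e ∈ E(H), ¬ ∃ c, ∀ v ∈ e, X v = c

end Hypergraph

namespace BucketScan

/-- The number of buckets used for `q` colours. -/
noncomputable def numBuckets (q : ℕ) : ℕ := ⌈Real.sqrt (q : ℝ)⌉₊

/-- A balanced projection scheme `[q] → [s]`: every fibre has `⌊q/s⌋` or `⌈q/s⌉` elements. -/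
def IsBalanced {q s : ℕ} (h : Fin q → Fin s) : Prop :=
  ∀ j : Fin s, (Finset.univ.filter fun i => h i = j).card = ⌊(q : ℝ) / s⌋₊ ∨
    (Finset.univ.filter fun i => h i = j).card = ⌈(q : ℝ) / s⌉₊

section Distributions

variable {V : Type*} [Fintype V] [DecidableEq V]

open Classical in
/-- The uniform distribution on the proper `q`-colourings of `H` (identically zero if there are
none). -/
noncomputable def colouringDist (H : Hypergraph V) (q : ℕ) (X : V → Fin q) : ℝ :=
  if H.IsProper X then
    1 / ((Finset.univ.filter fun Z : V → Fin q => H.IsProper Z).card : ℝ)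
  else 0

/-- The projected distribution: the law of `v ↦ h (X v)` where `X` is a uniformly random proper
colouring. -/
noncomputable def projectedDist (H : Hypergraph V) {q s : ℕ} (h : Fin q → Fin s)
    (Y : V → Fin s) : ℝ :=
  ∑ X : V → Fin q, if (fun v => h (X v)) = Y then colouringDist H q X else 0

/-- `condMarginal ν v Y c` is the probability that `Z v = c`, for `Z` drawn from `ν`
conditioned on `Z u = Y u` for all `u ≠ v`. -/
noncomputable def condMarginal {s : ℕ} (ν : (V → Fin s) → ℝ) (v : V) (Y : V → Fin s)
    (c : Fin s) : ℝ :=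
  ν (Function.update Y v c) / ∑ c' : Fin s, ν (Function.update Y v c')

/-- The transition matrix of one heat-bath update at `v`: all other coordinates are kept, and the
new value at `v` is drawn from the conditional law of that coordinate under `ν`. -/
noncomputable def heatBath {s : ℕ} (ν : (V → Fin s) → ℝ) (v : V) :
    Matrix (V → Fin s) (V → Fin s) ℝ :=
  Matrix.of fun X Y => if ∀ u, u ≠ v → Y u = X u then condMarginal ν v X (Y v) else 0

/-- The systematic scan for `ν`: the transition at step `t` (steps are `1, 2, 3, …`) is the
heat-bath update at the vertex with label `t mod n`. -/
noncomputable def systematicScan {s n : ℕ} [NeZero n] (ν : (V → Fin s) → ℝ) (label : V ≃ Fin n)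
    (t : ℕ) : Matrix (V → Fin s) (V → Fin s) ℝ :=
  heatBath ν (label.symm ⟨t % n, Nat.mod_lt t (NeZero.pos n)⟩)

end Distributions

/-! A (possibly time-inhomogeneous) Markov chain on a finite state space is given by its sequence
`P` of transition matrices, `P t` being the transition from time `t - 1` to time `t` for `t ≥ 1`.
A time-homogeneous chain is a constant sequence. -/

section Chains

variable {Ω : Type*} [Fintype Ω] [DecidableEq Ω]

/-- `multiStep P r t = P (r + 1) * P (r + 2) * ⋯ * P (r + t)`: the transition matrix from time `r`
to time `r + t`. -/
def multiStep (P : ℕ → Matrix Ω Ω ℝ) (r : ℕ) : ℕ → Matrix Ω Ω ℝ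
  | 0 => 1
  | t + 1 => multiStep P r t * P (r + t + 1)

/-- From any time on, every state can be reached from every state in a positive number of steps. -/
def IsIrreducible (P : ℕ → Matrix Ω Ω ℝ) : Prop :=
  ∀ (r : ℕ) (X Y : Ω), ∃ t : ℕ, 0 < t ∧ 0 < multiStep P r t X Y

/-- From any time on, the possible return times of every state have greatest common divisor `1`. -/
def IsAperiodic (P : ℕ → Matrix Ω Ω ℝ) : Prop :=
  ∀ (r : ℕ) (X : Ω) (d : ℕ), (∀ t : ℕ, 0 < multiStep P r t X X → d ∣ t) → d = 1

/-- Every transition satisfies the detailed balance condition with respect to `π`. -/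
def IsReversible (P : ℕ → Matrix Ω Ω ℝ) (π : Ω → ℝ) : Prop :=
  ∀ t : ℕ, 1 ≤ t → ∀ X Y : Ω, π X * P t X Y = π Y * P t Y X

/-- Total variation distance. -/
noncomputable def tvDist (μ ν : Ω → ℝ) : ℝ := (1 / 2) * ∑ x, |μ x - ν x|

/-- The mixing time `min {t | max_X d_TV(P^t(X, ·), π) < ε}`; it is `⊤` if there is no such `t`. -/
noncomputable def mixingTime (P : ℕ → Matrix Ω Ω ℝ) (π : Ω → ℝ) (ε : ℝ) : ℕ∞ :=
  ⨅ t ∈ {t : ℕ | ∀ X : Ω, tvDist (fun Y => multiStep P 0 t X Y) π < ε}, (t : ℕ∞)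

end Chains

end BucketScan

/-! The mixing bound is Dobrushin's uniqueness method. The influence of `u` on `v` measures how much
the conditional law at `v` under the projected distribution can change when only the bucket of `u`
changes. Once the influences on every `v` sum to at most 1/2, each full sweep halves the total
oscillation of any test function (`HasOsc.multiStep_sweeps`), and `tvDist_le_of_hasOsc` turns this
into a total variation bound.

Prescribing buckets gives list colourings: the conditional law at `v` is the bucket law of the
colour of `v` in a uniform proper list colouring whose lists are buckets, except for the full list
at `v`. Changing the bucket of `u` changes one list. Two inputs control such a change.

Counting: adding a vertex multiplies the number of proper list colourings by at least β
(`card_insert_ge`, an induction replacing the local lemma). Hence prescribed colours on `S` have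
probability at most β^(-|S|).

Percolation: draw independent colourings X, Y for the two lists. Exchanging them off the component
of `u` formed by bad edges preserves properness and the lists, so the laws at `v` can differ only
through the event that `u` and `v` are connected (`sum_abs_marginal_le`). A shortest connecting
chain in a linear hypergraph meets `k - 1` new vertices with each edge, so an edge costs at most
q(2/β)^(k-1). The sum over chains is a geometric series of ratio at most 1/5 (`card_conn_le`,
`sum_pathWeight_le`).

Positivity of all conditional laws gives irreducibility and aperiodicity; reversibility is the usual
heat-bath identity. -/

namespace BucketScan

/-! ### Counting list colourings by adding one vertex at a time -/

section Counting

set_option linter.unusedSectionVars false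

variable {V C : Type*} [Fintype V] [DecidableEq V] [DecidableEq C]

/-- All vertices of `e` have the same colour. -/
def Mono (X : V → C) (e : Finset V) : Prop := ∃ c, ∀ w ∈ e, X w = c

open Classical in
/-- The proper list colourings of the subhypergraph induced by `U`, extended by the colour `d`
outside of `U`. -/
noncomputable def partialColourings (E : Finset (Finset V)) (L : V → Finset C) (d : C)
    (U : Finset V) : Finset (V → C) :=
  (Fintype.piFinset fun w => if w ∈ U then L w else {d}).filter
    fun X => ∀ e ∈ E, e ⊆ U → ¬ Mono X e

/-- Recolour all vertices of `S` with `d`. -/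
def reset (d : C) (S : Finset V) (X : V → C) : V → C := fun w => if w ∈ S then d else X w

variable {E : Finset (Finset V)} {L : V → Finset C} {d : C} {U : Finset V}

theorem mem_partialColourings {X : V → C} :
    X ∈ partialColourings E L d U ↔
      (∀ w, X w ∈ if w ∈ U then L w else {d}) ∧ ∀ e ∈ E, e ⊆ U → ¬ Mono X e := by
  simp [partialColourings]

theorem reset_mem {X : V → C} (S : Finset V)
    (hX : ∀ w, X w ∈ if w ∈ U then L w else {d})
    (hE : ∀ e ∈ E, e ⊆ U \ S → ¬ Mono X e) :
    reset d S X ∈ partialColourings E L d (U \ S) := by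
  rw [mem_partialColourings]
  refine ⟨fun w => ?_, fun e he heU hm => hE e he heU ?_⟩
  · have := hX w
    by_cases hS : w ∈ S <;> simp_all [reset]
  · obtain ⟨c, hc⟩ := hm
    refine ⟨c, fun w hw => ?_⟩
    have := hc w hw
    have hwS := (Finset.mem_sdiff.1 (heU hw)).2
    simpa [reset, hwS] using this

/-- Forgetting prescribed values loses no information, and deleting vertices only removes
constraints. The default colour `d` outside `U` makes restrictions comparable as total functions. -/
theorem card_fixed_le (S : Finset V) (σ : V → C) :
    ((partialColourings E L d U).filter fun X => ∀ w ∈ S, X w = σ w).card ≤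
      (partialColourings E L d (U \ S)).card := by
  refine Finset.card_le_card_of_injOn (reset d S) ?_ ?_
  · intro X hX
    simp only [Finset.coe_filter, Set.mem_ofPred_eq] at hX
    obtain ⟨h1, h2⟩ := mem_partialColourings.1 hX.1
    exact reset_mem S h1 fun e he heU => h2 e he (heU.trans Finset.sdiff_subset)
  · intro X hX Y hY hXY
    simp only [Finset.coe_filter, Set.mem_ofPred_eq] at hX hY
    funext w
    by_cases hw : w ∈ S
    · rw [hX.2 w hw, hY.2 w hw]
    · simpa [reset, hw] using congrFun hXY w

open Classical in
/-- The extensions of the partial colourings on `U` to `v` that need not be proper at `v`. -/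
noncomputable def extensions (E : Finset (Finset V)) (L : V → Finset C) (d : C)
    (U : Finset V) (v : V) : Finset (V → C) :=
  (Fintype.piFinset fun w => if w ∈ insert v U then L w else {d}).filter
    fun X => ∀ e ∈ E, e ⊆ U → ¬ Mono X e

theorem mem_extensions {X : V → C} {v : V} :
    X ∈ extensions E L d U v ↔
      (∀ w, X w ∈ if w ∈ insert v U then L w else {d}) ∧ ∀ e ∈ E, e ⊆ U → ¬ Mono X e := by
  simp [extensions]

theorem card_extensions {v : V} (hv : v ∉ U) :
    (L v).card * (partialColourings E L d U).card ≤ (extensions E L d U v).card := by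
  rw [← Finset.card_product]
  refine Finset.card_le_card_of_injOn (fun p => Function.update p.2 v p.1) ?_ ?_
  · rintro ⟨c, X⟩ hp
    simp only [Finset.coe_product, Set.mem_prod, Finset.mem_coe] at hp
    obtain ⟨h1, h2⟩ := mem_partialColourings.1 hp.2
    refine Finset.mem_coe.2 (mem_extensions.2 ⟨fun w => ?_, fun e he heU hm => h2 e he heU ?_⟩)
    · by_cases hw : w = v
      · subst hw; simpa using hp.1
      · have := h1 w
        simpa [hw] using this
    · obtain ⟨c', hc⟩ := hm
      refine ⟨c', fun w hw => ?_⟩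
      have hwv : w ≠ v := fun h => hv (h ▸ heU hw)
      simpa [hwv] using hc w hw
  · rintro ⟨c, X⟩ hp ⟨c', X'⟩ hp' h
    simp only [Finset.coe_product, Set.mem_prod, Finset.mem_coe] at hp hp'
    have e1 := (mem_partialColourings.1 hp.2).1 v
    have e2 := (mem_partialColourings.1 hp'.2).1 v
    simp only [hv, if_false, Finset.mem_singleton] at e1 e2
    simp only at h
    refine Prod.ext ?_ ?_
    · simpa using congrFun h v
    · funext w
      by_cases hw : w = v
      · subst hw; simp only [e1, e2]
      · simpa [hw] using congrFun h w

-- The colour of the single vertex `w` kept from a monochromatic `e` determines all the others, so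
-- everything in `e` but `w` can be forgotten, including `v`.
open Classical in
theorem card_mono_extensions {v w : V} {e : Finset V} (hv : v ∉ U)
    (hve : v ∈ e) (hwe : w ∈ e) (hwv : w ≠ v) :
    ((extensions E L d U v).filter fun X => Mono X e).card ≤
      (partialColourings E L d (U \ e.erase w)).card := by
  have hU : insert v U \ e.erase w = U \ e.erase w := by
    ext x
    by_cases hx : x = v
    · subst hx; simp [hv, hve, hwv.symm]
    · simp [hx]
  refine Finset.card_le_card_of_injOn (reset d (e.erase w)) ?_ ?_
  · intro X hX
    simp only [Finset.coe_filter, Set.mem_ofPred_eq] at hX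
    obtain ⟨h1, h2⟩ := mem_extensions.1 hX.1
    rw [← hU]
    refine reset_mem _ h1 fun f hf hfU => h2 f hf ?_
    rw [hU] at hfU
    exact hfU.trans Finset.sdiff_subset
  · intro X hX Y hY hXY
    simp only [Finset.coe_filter, Set.mem_ofPred_eq] at hX hY
    obtain ⟨c, hc⟩ := hX.2
    obtain ⟨c', hc'⟩ := hY.2
    have hcc : c = c' := by
      have := congrFun hXY w
      simpa [reset, hc w hwe, hc' w hwe] using this
    funext x
    by_cases hx : x ∈ e
    · rw [hc x hx, hc' x hx, hcc]
    · have := congrFun hXY x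
      simpa [reset, hx] using this

theorem extensions_subset {v : V} :
    extensions E L d U v ⊆ partialColourings E L d (insert v U) ∪
      (E.filter fun e => v ∈ e ∧ e ⊆ insert v U).biUnion fun e =>
        open Classical in (extensions E L d U v).filter fun X => Mono X e := by
  classical
  intro X hX
  obtain ⟨h1, h2⟩ := mem_extensions.1 hX
  by_cases hp : X ∈ partialColourings E L d (insert v U)
  · exact Finset.mem_union_left _ hp
  · apply Finset.mem_union_right
    rw [mem_partialColourings] at hp
    push Not at hp
    obtain ⟨e, he, heU, hm⟩ := hp h1
    have hve : v ∈ e := by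
      by_contra hve
      exact h2 e he ((Finset.subset_insert_iff_of_notMem hve).1 heU) hm
    simp only [Finset.mem_biUnion, Finset.mem_filter]
    exact ⟨e, ⟨he, hve, heU⟩, hX, hm⟩

variable {k Δ : ℕ} {β : ℝ}

/-- Telescoping of the one-vertex growth bound. Growth is assumed only below size `n`, so that the
lemma can be used inside the induction that proves this growth. -/
theorem chain_le (hβ : 0 ≤ β) {N : Finset V → ℝ} {n : ℕ}
    (ih : ∀ U : Finset V, U.card < n → ∀ v ∉ U, β * N U ≤ N (insert v U)) {S U : Finset V}
    (hU : U.card ≤ n) (hS : S ⊆ U) : β ^ (U \ S).card * N S ≤ N U := by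
  induction hT : U \ S using Finset.induction_on generalizing U with
  | empty =>
    have : U = S := Finset.Subset.antisymm (Finset.sdiff_eq_empty_iff_subset.1 hT) hS
    simp [this]
  | insert v T hv ihT =>
    have hvU : v ∈ U \ S := hT ▸ Finset.mem_insert_self v T
    rw [Finset.mem_sdiff] at hvU
    have h1 : U.erase v \ S = T := by
      rw [Finset.erase_sdiff_comm, hT, Finset.erase_insert hv]
    have hcard : (U.erase v).card < U.card := Finset.card_erase_lt_of_mem hvU.1
    have h2 := ihT (U := U.erase v) (hcard.le.trans hU) (fun x hx => Finset.mem_erase.2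
      ⟨fun h => hvU.2 (h ▸ hx), hS hx⟩) h1
    have h3 := ih (U.erase v) (hcard.trans_le hU) v (Finset.notMem_erase v U)
    rw [Finset.insert_erase hvU.1] at h3
    rw [Finset.card_insert_of_notMem hv, pow_succ', mul_assoc]
    exact (mul_le_mul_of_nonneg_left h2 hβ).trans h3

/-- Of the at least |L v|·N(U) extensions to `v`, each of the at most Δ edges at `v` spoils at most
N(U)/β^(k-2), by the growth bound for smaller sets. The assumption on list sizes leaves the factor
β. -/
theorem card_insert_ge (hk : 2 ≤ k) (hunif : ∀ e ∈ E, e.card = k)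
    (hdeg : ∀ v, (E.filter fun e => v ∈ e).card ≤ Δ) (hβ : 0 < β)
    (hL : ∀ w, β + Δ / β ^ (k - 2) ≤ (L w).card) (v : V) (hv : v ∉ U) :
    β * (partialColourings E L d U).card ≤ (partialColourings E L d (insert v U)).card := by
  classical
  induction hn : U.card using Nat.strong_induction_on generalizing U v with
  | _ n ih =>
  let N : Finset V → ℝ := fun U => ((partialColourings E L d U).card : ℝ)
  have hchain : ∀ S ⊆ U, β ^ (U \ S).card * N S ≤ N U := fun S hS =>
    chain_le hβ.le (N := N) (n := n)
      (fun U' hU' v' hv' => ih U'.card hU' (U := U') v' hv' rfl) hn.le hS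
  have hbad : ∀ e ∈ E.filter fun e => v ∈ e ∧ e ⊆ insert v U,
      (((extensions E L d U v).filter fun X => Mono X e).card : ℝ) ≤ N U / β ^ (k - 2) := by
    intro e he
    simp only [Finset.mem_filter] at he
    obtain ⟨heE, hve, heU⟩ := he
    have hc := hunif e heE
    obtain ⟨w, hwe, hwv⟩ := Finset.exists_mem_ne (by omega : 1 < e.card) v
    have h1 := card_mono_extensions (E := E) (L := L) (d := d) hv hve hwe hwv
    have h2 := hchain (U \ e.erase w) Finset.sdiff_subset
    -- Since `v` is not in `U`, only `k - 2` vertices of `U` are forgotten; this is the source of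
    -- the exponent.
    have h3 : U \ (U \ e.erase w) = (e.erase w).erase v := by
      ext x
      simp only [Finset.mem_sdiff, Finset.mem_erase]
      constructor
      · rintro ⟨hx, hx2⟩
        refine ⟨fun h => hv (h ▸ hx), ?_⟩
        by_contra h
        exact hx2 ⟨hx, h⟩
      · rintro ⟨hxv, hxw, hxe⟩
        have := heU hxe
        simp only [Finset.mem_insert, hxv, false_or] at this
        exact ⟨this, fun h => h.2 ⟨hxw, hxe⟩⟩
    rw [h3, Finset.card_erase_of_mem (Finset.mem_erase.2 ⟨hwv.symm, hve⟩),
      Finset.card_erase_of_mem hwe, hc, Nat.sub_sub] at h2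
    rw [le_div_iff₀ (by positivity), mul_comm]
    refine le_trans ?_ h2
    exact mul_le_mul_of_nonneg_left (Nat.cast_le.2 h1) (by positivity)
  have hsub := Finset.card_le_card (extensions_subset (E := E) (L := L) (d := d) (U := U) (v := v))
  have h4 := hsub.trans ((Finset.card_union_le _ _).trans
    (Nat.add_le_add_left Finset.card_biUnion_le _))
  have h5 : ((extensions E L d U v).card : ℝ) ≤ N (insert v U) +
      ∑ e ∈ E.filter fun e => v ∈ e ∧ e ⊆ insert v U,
        (((extensions E L d U v).filter fun X => Mono X e).card : ℝ) := by
    simp only [N]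
    exact_mod_cast h4
  have h6 := Finset.sum_le_card_nsmul _ _ _ hbad
  have h7 : (((E.filter fun e => v ∈ e ∧ e ⊆ insert v U).card : ℕ) : ℝ) ≤ Δ := by
    refine Nat.cast_le.2 (le_trans (Finset.card_le_card ?_) (hdeg v))
    intro e he
    simp only [Finset.mem_filter] at he ⊢
    exact ⟨he.1, he.2.1⟩
  have h8 : ((L v).card : ℝ) * N U ≤ (extensions E L d U v).card := by
    have := card_extensions (E := E) (L := L) (d := d) hv
    simp only [N]
    exact_mod_cast this
  have hN0 : 0 ≤ N U := Nat.cast_nonneg _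
  rw [nsmul_eq_mul] at h6
  have h9 : (((E.filter fun e => v ∈ e ∧ e ⊆ insert v U).card : ℕ) : ℝ) * (N U / β ^ (k - 2)) ≤
      Δ * (N U / β ^ (k - 2)) := mul_le_mul_of_nonneg_right h7 (by positivity)
  have h10 := mul_le_mul_of_nonneg_right (hL v) hN0
  have h11 : (β + Δ / β ^ (k - 2)) * N U = β * N U + Δ * (N U / β ^ (k - 2)) := by ring
  change β * N U ≤ N (insert v U)
  linarith

open Classical in
/-- The proper list colourings. -/
noncomputable def listColourings (E : Finset (Finset V)) (L : V → Finset C) : Finset (V → C) :=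
  (Fintype.piFinset L).filter fun X => ∀ e ∈ E, ¬ Mono X e

theorem mem_listColourings {X : V → C} :
    X ∈ listColourings E L ↔ (∀ w, X w ∈ L w) ∧ ∀ e ∈ E, ¬ Mono X e := by
  simp [listColourings]

theorem partialColourings_univ : partialColourings E L d Finset.univ = listColourings E L := by
  ext X
  simp [mem_partialColourings, mem_listColourings]

/-- In a uniform list colouring, prescribed colours cost a factor of at least β per vertex, as if
the vertices were independent. -/
theorem card_fixed_listColourings (hk : 2 ≤ k) (hunif : ∀ e ∈ E, e.card = k)
    (hdeg : ∀ v, (E.filter fun e => v ∈ e).card ≤ Δ) (hβ : 0 < β)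
    (hL : ∀ w, β + Δ / β ^ (k - 2) ≤ (L w).card) (S : Finset V) (σ : V → C) :
    β ^ S.card * ((listColourings E L).filter fun X => ∀ w ∈ S, X w = σ w).card ≤
      (listColourings E L).card := by
  classical
  rcases isEmpty_or_nonempty V with hV | ⟨⟨v⟩⟩
  · rw [Finset.eq_empty_of_isEmpty S]
    simp
  have h1 := card_fixed_le (E := E) (L := L) (d := σ v) (U := Finset.univ) S σ
  rw [partialColourings_univ] at h1
  have h2 := chain_le hβ.le (N := fun U => ((partialColourings E L (σ v) U).card : ℝ))
    (n := (Finset.univ : Finset V).card) (S := Finset.univ \ S) (U := Finset.univ)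
    (fun U _ v hv => card_insert_ge hk hunif hdeg hβ hL v hv) le_rfl (Finset.subset_univ _)
  rw [partialColourings_univ, Finset.sdiff_sdiff_eq_self (Finset.subset_univ _)] at h2
  refine le_trans ?_ h2
  exact mul_le_mul_of_nonneg_left (by exact_mod_cast h1) (by positivity)

theorem listColourings_nonempty [Nonempty C] (hk : 2 ≤ k) (hunif : ∀ e ∈ E, e.card = k)
    (hdeg : ∀ v, (E.filter fun e => v ∈ e).card ≤ Δ) (hβ : 0 < β)
    (hL : ∀ w, β + Δ / β ^ (k - 2) ≤ (L w).card) : (listColourings E L).Nonempty := by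
  classical
  obtain ⟨d⟩ := ‹Nonempty C›
  have h2 := chain_le hβ.le (N := fun U => ((partialColourings E L d U).card : ℝ))
    (n := (Finset.univ : Finset V).card) (S := ∅) (U := Finset.univ)
    (fun U _ v hv => card_insert_ge hk hunif hdeg hβ hL v hv) le_rfl (Finset.subset_univ _)
  rw [partialColourings_univ] at h2
  have h3 : (fun _ => d) ∈ partialColourings E L d ∅ := by
    refine mem_partialColourings.2 ⟨by simp, fun e he heU => ?_⟩
    have := hunif e he
    rw [Finset.subset_empty.1 heU, Finset.card_empty] at this
    omega
  have h4 : (0 : ℝ) < (partialColourings E L d ∅).card :=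
    Nat.cast_pos.2 (Finset.card_pos.2 ⟨_, h3⟩)
  have h5 : (0 : ℝ) < (listColourings E L).card := lt_of_lt_of_le (by positivity) h2
  exact Finset.card_pos.1 (by exact_mod_cast h5)

end Counting

/-! ### Bad edges, chains between two colourings, and the exchange argument -/

section Percolation

set_option linter.unusedSectionVars false

variable {V C : Type*} [Fintype V] [DecidableEq V] [Fintype C] [DecidableEq C]

/-- Some colour appears at every vertex of `e` in at least one of the two colourings. -/
def Bad (X Y : V → C) (e : Finset V) : Prop := ∃ c, ∀ w ∈ e, X w = c ∨ Y w = c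

/-- There is a chain of `n` bad edges from the given vertex to `u`. -/
def Reach (E : Finset (Finset V)) (X Y : V → C) (u : V) : ℕ → V → Prop
  | 0, w => w = u
  | n + 1, w => ∃ e ∈ E, Bad X Y e ∧ w ∈ e ∧ ∃ w' ∈ e, Reach E X Y u n w'

/-- There is a chain of `n` bad edges from `v` to `u` such that every edge, except for the vertex
where it is entered, avoids `U` and the earlier edges. -/
def GoodPath (E : Finset (Finset V)) (X Y : V → C) (u : V) : ℕ → Finset V → V → Prop
  | 0, _, v => v = u
  | n + 1, U, v => ∃ e ∈ E, Bad X Y e ∧ v ∈ e ∧ Disjoint (e.erase v) U ∧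
      ∃ w ∈ e, GoodPath E X Y u n (U ∪ e) w

/-- The total weight of the edge chains of length `n` from `v` to `u`, with weight `ρ` per edge. -/
noncomputable def pathWeight (E : Finset (Finset V)) (ρ : ℝ) (u : V) : ℕ → V → ℝ
  | 0, v => if v = u then 1 else 0
  | n + 1, v => ∑ e ∈ E.filter fun e => v ∈ e, ∑ w ∈ e, ρ * pathWeight E ρ u n w

variable {E : Finset (Finset V)} {X Y : V → C} {u v : V} {k Δ : ℕ} {β ρ : ℝ}

theorem pathWeight_nonneg (hρ : 0 ≤ ρ) (n : ℕ) (v : V) : 0 ≤ pathWeight E ρ u n v := by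
  induction n generalizing v with
  | zero => unfold pathWeight; split_ifs <;> norm_num
  | succ n ih =>
    unfold pathWeight
    exact Finset.sum_nonneg fun e _ => Finset.sum_nonneg fun w _ => mul_nonneg hρ (ih w)

theorem sum_pathWeight_le (hunif : ∀ e ∈ E, e.card = k)
    (hdeg : ∀ v, (E.filter fun e => v ∈ e).card ≤ Δ) (hρ : 0 ≤ ρ) (n : ℕ) (v : V) :
    ∑ u, pathWeight E ρ u n v ≤ (Δ * (k * ρ)) ^ n := by
  induction n generalizing v with
  | zero => simp [pathWeight]
  | succ n ih =>
    simp only [pathWeight]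
    rw [Finset.sum_comm]
    have h1 : ∀ e ∈ E.filter fun e => v ∈ e,
        ∑ u, ∑ w ∈ e, ρ * pathWeight E ρ u n w ≤ k * ρ * (Δ * (k * ρ)) ^ n := by
      intro e he
      rw [Finset.sum_comm]
      have h2 : ∀ w ∈ e, ∑ u, ρ * pathWeight E ρ u n w ≤ ρ * (Δ * (k * ρ)) ^ n := by
        intro w _
        rw [← Finset.mul_sum]
        exact mul_le_mul_of_nonneg_left (ih w) hρ
      refine (Finset.sum_le_card_nsmul _ _ _ h2).trans_eq ?_
      rw [hunif e (Finset.mem_filter.1 he).1, nsmul_eq_mul]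
      ring
    refine (Finset.sum_le_card_nsmul _ _ _ h1).trans ?_
    rw [nsmul_eq_mul, pow_succ', mul_assoc (Δ : ℝ)]
    refine mul_le_mul_of_nonneg_right (Nat.cast_le.2 (hdeg v)) ?_
    positivity

theorem Reach.of_mem {n : ℕ} {e : Finset V} {w y : V} (he : e ∈ E) (hb : Bad X Y e)
    (hw : w ∈ e) (hr : Reach E X Y u n w) (hy : y ∈ e) : Reach E X Y u (n + 1) y :=
  ⟨e, he, hb, hy, w, hw, hr⟩

/-- Follow a shortest chain to `u`. The hypothesis on `U` is an invariant for the vertices already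
visited: each is farther from `u` than `v`, or lies on an edge through `v` with no vertex closer to
`u` than `v`, or is `v`. In the second case the next edge is different, because it contains a closer
vertex, so linearity lets the two edges meet only at `v`. -/
theorem goodPath_of_reach (hlin : ∀ e ∈ E, ∀ f ∈ E, e ≠ f → (e ∩ f).card ≤ 1)
    (n : ℕ) (U : Finset V) (v : V) (hr : Reach E X Y u n v)
    (hmin : ∀ m < n, ¬ Reach E X Y u m v)
    (hU : ∀ y ∈ U, (∀ m ≤ n, ¬ Reach E X Y u m y) ∨
      (∃ f ∈ E, v ∈ f ∧ y ∈ f ∧ ∀ z ∈ f, ∀ m < n, ¬ Reach E X Y u m z) ∨ y = v) :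
    GoodPath E X Y u n U v := by
  induction n generalizing U v with
  | zero => exact hr
  | succ n ih =>
    obtain ⟨e, he, hb, hve, w, hwe, hw⟩ := hr
    have hfar : ∀ z ∈ e, ∀ m < n, ¬ Reach E X Y u m z := fun z hz m hm hrz =>
      hmin (m + 1) (by omega) (Reach.of_mem he hb hz hrz hve)
    refine ⟨e, he, hb, hve, ?_, w, hwe, ih _ _ hw (hfar w hwe) ?_⟩
    · rw [Finset.disjoint_left]
      intro y hye hyU
      obtain ⟨hyv, hye⟩ := Finset.mem_erase.1 hye
      rcases hU y hyU with h | ⟨f, hf, hvf, hyf, hff⟩ | h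
      · exact h (n + 1) le_rfl (Reach.of_mem he hb hwe hw hye)
      · have hef : e ≠ f := fun h => hff w (h ▸ hwe) n (by omega) hw
        have := Finset.card_le_one.1 (hlin e he f hf hef) y (Finset.mem_inter.2 ⟨hye, hyf⟩) v
          (Finset.mem_inter.2 ⟨hve, hvf⟩)
        exact hyv this
      · exact hyv h
    · intro y hy
      rcases Finset.mem_union.1 hy with hy | hy
      · left
        rcases hU y hy with h | ⟨f, hf, hvf, hyf, hff⟩ | h
        · exact fun m hm => h m (by omega)
        · exact fun m hm => hff y hyf m (by omega)
        · exact fun m hm => h ▸ hmin m (by omega)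
      · exact Or.inr (Or.inl ⟨e, he, hwe, hy, hfar⟩)

theorem exists_goodPath (hlin : ∀ e ∈ E, ∀ f ∈ E, e ≠ f → (e ∩ f).card ≤ 1) {N : ℕ}
    (h : ∃ n < N, Reach E X Y u n v) : ∃ n < N, GoodPath E X Y u n {v} v := by
  classical
  have h' : ∃ n, Reach E X Y u n v := h.imp fun _ => And.right
  obtain ⟨n, hn, hr⟩ := h
  refine ⟨Nat.find h', (Nat.find_min' h' hr).trans_lt hn,
    goodPath_of_reach hlin _ _ _ (Nat.find_spec h') (fun m => Nat.find_min h') ?_⟩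
  intro y hy
  exact Or.inr (Or.inr (Finset.mem_singleton.1 hy))

/-- A common cut-off makes the sum over chain lengths finite. Its value is irrelevant, since the
geometric series is bounded uniformly in `N`. -/
theorem exists_reach_bound (E : Finset (Finset V)) : ∃ N : ℕ, ∀ (X Y : V → C) (u v : V),
    (∃ n, Reach E X Y u n v) → ∃ n < N, Reach E X Y u n v := by
  classical
  choose! f hf using fun (p : ((V → C) × (V → C)) × V × V)
    (h : ∃ n, Reach E p.1.1 p.1.2 p.2.1 n p.2.2) => h
  refine ⟨Finset.univ.sup f + 1, fun X Y u v h => ⟨f ((X, Y), u, v), ?_, hf ((X, Y), u, v) h⟩⟩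
  exact Nat.lt_succ_of_le (Finset.le_sup (Finset.mem_univ _))

variable {L L' : V → Finset C}

-- Union bound over the first edge, its exit vertex `w`, the covering colour `c`, and the set `B` of
-- new vertices where the first colouring shows `c`. `S` and `T` record the values already
-- prescribed in the two colourings; freshness of each edge adds exactly `k - 1` prescriptions.
open Classical in
theorem card_goodPath_le (hk : 2 ≤ k) (hunif : ∀ e ∈ E, e.card = k)
    (hdeg : ∀ v, (E.filter fun e => v ∈ e).card ≤ Δ) (hβ : 0 < β)
    (hL : ∀ w, β + Δ / β ^ (k - 2) ≤ (L w).card) (hL' : ∀ w, β + Δ / β ^ (k - 2) ≤ (L' w).card)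
    (n : ℕ) (U S T : Finset V) (hS : S ⊆ U) (hT : T ⊆ U) (σ : V → C) (v : V) :
    (((listColourings E L ×ˢ listColourings E L').filter fun p =>
      (∀ w ∈ S, p.1 w = σ w) ∧ (∀ w ∈ T, p.2 w = σ w) ∧ GoodPath E p.1 p.2 u n U v).card : ℝ) ≤
    pathWeight E (Fintype.card C * (2 / β) ^ (k - 1)) u n v *
      ((listColourings E L).card * (listColourings E L').card) / β ^ (S.card + T.card) := by
  set ρ : ℝ := Fintype.card C * (2 / β) ^ (k - 1) with hρ
  have hρ0 : 0 ≤ ρ := by positivity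
  set M : ℝ := ((listColourings E L).card * (listColourings E L').card : ℝ) with hM
  have hM0 : 0 ≤ M := by positivity
  induction n generalizing U S T σ v with
  | zero =>
    by_cases hvu : v = u
    · have h1 := card_fixed_listColourings hk hunif hdeg hβ hL S σ
      have h2 := card_fixed_listColourings hk hunif hdeg hβ hL' T σ
      rw [le_div_iff₀ (by positivity)]
      have h3 : ((listColourings E L ×ˢ listColourings E L').filter fun p =>
          (∀ w ∈ S, p.1 w = σ w) ∧ (∀ w ∈ T, p.2 w = σ w) ∧ GoodPath E p.1 p.2 u 0 U v) =
          ((listColourings E L).filter fun X => ∀ w ∈ S, X w = σ w) ×ˢ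
          ((listColourings E L').filter fun X => ∀ w ∈ T, X w = σ w) := by
        ext p
        simp only [Finset.mem_filter, Finset.mem_product, GoodPath, hvu]
        tauto
      rw [h3, Finset.card_product, Nat.cast_mul, pow_add]
      have h4 := mul_le_mul h1 h2 (by positivity) (by positivity)
      simp only [pathWeight, hvu, if_true, one_mul, hM]
      calc _ = _ := ?_
        _ ≤ _ := h4
      ring_nf
    · have h3 : ((listColourings E L ×ˢ listColourings E L').filter fun p =>
          (∀ w ∈ S, p.1 w = σ w) ∧ (∀ w ∈ T, p.2 w = σ w) ∧ GoodPath E p.1 p.2 u 0 U v) = ∅ := by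
        refine Finset.filter_eq_empty_iff.2 fun p _ h => hvu h.2.2
      rw [h3]
      simp [pathWeight, hvu]
  | succ n ih =>
    -- One prescription serves both colourings: `c` on the new vertices, required of the first on
    -- `B` and of the second off `B`, and the old `σ` elsewhere.
    let F : Finset V → V → C → Finset V → Finset ((V → C) × (V → C)) := fun e w c B =>
      (listColourings E L ×ˢ listColourings E L').filter fun p =>
        (∀ x ∈ S ∪ B, p.1 x = if x ∈ e.erase v then c else σ x) ∧
        (∀ x ∈ T ∪ (e.erase v \ B), p.2 x = if x ∈ e.erase v then c else σ x) ∧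
        GoodPath E p.1 p.2 u n (U ∪ e) w
    let E' := (E.filter fun e => v ∈ e).filter fun e => Disjoint (e.erase v) U
    have hsub : ((listColourings E L ×ˢ listColourings E L').filter fun p =>
        (∀ w ∈ S, p.1 w = σ w) ∧ (∀ w ∈ T, p.2 w = σ w) ∧
          GoodPath E p.1 p.2 u (n + 1) U v) ⊆
        E'.biUnion fun e => e.biUnion fun w => Finset.univ.biUnion fun c =>
          (e.erase v).powerset.biUnion fun B => F e w c B := by
      intro p hp
      obtain ⟨hpA, h1, h2, e, he, ⟨c, hc⟩, hve, hdis, w, hwe, hgp⟩ := Finset.mem_filter.1 hp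
      simp only [Finset.mem_biUnion, Finset.mem_univ, true_and, Finset.mem_powerset]
      have hdis' := Finset.disjoint_right.1 hdis
      refine ⟨e, by simp [E', he, hve, hdis], w, hwe, c,
        (e.erase v).filter fun x => p.1 x = c, Finset.filter_subset _ _,
        Finset.mem_filter.2 ⟨hpA, fun x hx => ?_, fun x hx => ?_, hgp⟩⟩
      · rcases Finset.mem_union.1 hx with hx | hx
        · rw [if_neg (hdis' (hS hx)), h1 x hx]
        · rw [Finset.mem_filter] at hx
          rw [if_pos hx.1, hx.2]
      · rcases Finset.mem_union.1 hx with hx | hx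
        · rw [if_neg (hdis' (hT hx)), h2 x hx]
        · simp only [Finset.mem_sdiff, Finset.mem_filter, not_and] at hx
          rw [if_pos hx.1]
          exact (hc x (Finset.mem_of_mem_erase hx.1)).resolve_left (hx.2 hx.1)
    have hcard : ∀ e ∈ E', ∀ w ∈ e, ∀ c, ∀ B ∈ (e.erase v).powerset,
        ((F e w c B).card : ℝ) ≤
          pathWeight E ρ u n w * M / β ^ (S.card + T.card) / β ^ (k - 1) := by
      intro e he w hwe c B hB
      simp only [E', Finset.mem_filter] at he
      rw [Finset.mem_powerset] at hB
      have hdis' := Finset.disjoint_left.1 he.2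
      have hsubU : e.erase v ⊆ U ∪ e := (Finset.erase_subset _ _).trans Finset.subset_union_right
      have := ih (U ∪ e) (S ∪ B) (T ∪ (e.erase v \ B))
        (Finset.union_subset (hS.trans Finset.subset_union_left) (hB.trans hsubU))
        (Finset.union_subset (hT.trans Finset.subset_union_left)
          (Finset.sdiff_subset.trans hsubU)) (fun x => if x ∈ e.erase v then c else σ x) w
      refine this.trans_eq ?_
      rw [Finset.card_union_of_disjoint, Finset.card_union_of_disjoint,
        Finset.card_sdiff_of_subset hB, Finset.card_erase_of_mem he.1.2, hunif e he.1.1]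
      · have hle := Finset.card_le_card hB
        rw [Finset.card_erase_of_mem he.1.2, hunif e he.1.1] at hle
        rw [div_div, ← pow_add]
        congr 2
        omega
      · rw [Finset.disjoint_right]
        exact fun x hx hxT => hdis' (Finset.sdiff_subset hx) (hT hxT)
      · rw [Finset.disjoint_right]
        exact fun x hx hxS => hdis' (hB hx) (hS hxS)
    have hle := (Finset.card_le_card hsub).trans (Finset.card_biUnion_le.trans
      (Finset.sum_le_sum fun e _ => Finset.card_biUnion_le.trans
        (Finset.sum_le_sum fun w _ => Finset.card_biUnion_le.trans
          (Finset.sum_le_sum fun c _ => Finset.card_biUnion_le))))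
    refine (Nat.cast_le.2 hle).trans ?_
    push_cast
    have hE : ∀ e ∈ E', ∀ w ∈ e, ∑ c : C, ∑ B ∈ (e.erase v).powerset, ((F e w c B).card : ℝ) ≤
        ρ * pathWeight E ρ u n w * (M / β ^ (S.card + T.card)) := by
      intro e he w hwe
      refine (Finset.sum_le_sum fun c _ => Finset.sum_le_card_nsmul _ _ _
        (hcard e he w hwe c)).trans_eq ?_
      simp only [E', Finset.mem_filter] at he
      -- The |C| colours and the 2^(k-1) sets `B`, times β^(-(k-1)), make up `ρ`.
      rw [Finset.sum_const, Finset.card_univ, Finset.card_powerset,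
        Finset.card_erase_of_mem he.1.2, hunif e he.1.1, nsmul_eq_mul, nsmul_eq_mul, hρ, div_pow]
      push_cast
      ring
    refine (Finset.sum_le_sum fun e he => Finset.sum_le_sum fun w hw => hE e he w hw).trans ?_
    have hrhs : pathWeight E ρ u (n + 1) v * M / β ^ (S.card + T.card) =
        ∑ e ∈ E.filter fun e => v ∈ e, ∑ w ∈ e,
          ρ * pathWeight E ρ u n w * (M / β ^ (S.card + T.card)) := by
      rw [mul_div_assoc, pathWeight, Finset.sum_mul]
      exact Finset.sum_congr rfl fun e _ => Finset.sum_mul _ _ _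
    rw [hrhs]
    refine Finset.sum_le_sum_of_subset_of_nonneg (Finset.filter_subset _ _) fun e _ _ => ?_
    refine Finset.sum_nonneg fun w _ => ?_
    have := pathWeight_nonneg (E := E) (u := u) hρ0 n w
    positivity

/-- `u` and `v` are connected by bad edges. -/
def Conn (E : Finset (Finset V)) (X Y : V → C) (u v : V) : Prop := ∃ n, Reach E X Y u n v

open Classical in
theorem card_conn_le (hk : 2 ≤ k) (hunif : ∀ e ∈ E, e.card = k)
    (hlin : ∀ e ∈ E, ∀ f ∈ E, e ≠ f → (e ∩ f).card ≤ 1)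
    (hdeg : ∀ v, (E.filter fun e => v ∈ e).card ≤ Δ) (hβ : 0 < β)
    (hL : ∀ w, β + Δ / β ^ (k - 2) ≤ (L w).card) (hL' : ∀ w, β + Δ / β ^ (k - 2) ≤ (L' w).card)
    {N : ℕ} (hN : ∀ (X Y : V → C) (u v : V), (∃ n, Reach E X Y u n v) →
      ∃ n < N, Reach E X Y u n v) (u v : V) :
    (((listColourings E L ×ˢ listColourings E L').filter fun p =>
      Conn E p.1 p.2 u v).card : ℝ) ≤
    (∑ n ∈ Finset.range N, pathWeight E (Fintype.card C * (2 / β) ^ (k - 1)) u n v) *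
      ((listColourings E L).card * (listColourings E L').card) := by
  have hsub : ((listColourings E L ×ˢ listColourings E L').filter fun p =>
      Conn E p.1 p.2 u v) ⊆ (Finset.range N).biUnion fun n =>
        (listColourings E L ×ˢ listColourings E L').filter fun p =>
          (∀ w ∈ (∅ : Finset V), p.1 w = p.1 w) ∧ GoodPath E p.1 p.2 u n {v} v := by
    intro p hp
    obtain ⟨hpA, hc⟩ := Finset.mem_filter.1 hp
    obtain ⟨n, hn, h⟩ := exists_goodPath hlin (hN _ _ _ _ hc)
    simp only [Finset.mem_biUnion, Finset.mem_filter]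
    exact ⟨n, Finset.mem_range.2 hn, hpA, by simp, h⟩
  refine (Nat.cast_le.2 ((Finset.card_le_card hsub).trans Finset.card_biUnion_le)).trans ?_
  push_cast
  rw [Finset.sum_mul]
  refine Finset.sum_le_sum fun n _ => ?_
  rcases isEmpty_or_nonempty C with hC | ⟨⟨c⟩⟩
  · have : IsEmpty (V → C) := ⟨fun f => hC.false (f v)⟩
    rw [Finset.eq_empty_of_isEmpty (Finset.filter _ _),
      Finset.eq_empty_of_isEmpty (listColourings E L)]
    simp
  have := card_goodPath_le (u := u) hk hunif hdeg hβ hL hL' n {v} ∅ ∅ (by simp) (by simp)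
    (fun _ => c) v
  simpa using this

/-- Take the values of `X` on the component of `u` and those of `Y` elsewhere. -/
noncomputable def glue (E : Finset (Finset V)) (u : V) (p : (V → C) × (V → C)) : V → C :=
  fun w => open Classical in if Conn E p.1 p.2 u w then p.1 w else p.2 w

/-- Exchange the two colourings outside of the component of `u`. -/
noncomputable def swap (E : Finset (Finset V)) (u : V) (p : (V → C) × (V → C)) :
    (V → C) × (V → C) :=
  (glue E u p, fun w => open Classical in if Conn E p.1 p.2 u w then p.2 w else p.1 w)

theorem bad_swap {p : (V → C) × (V → C)} (e : Finset V) :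
    Bad (swap E u p).1 (swap E u p).2 e ↔ Bad p.1 p.2 e := by
  unfold Bad
  refine exists_congr fun c => forall₂_congr fun w _ => ?_
  simp only [swap, glue]
  split_ifs
  · rfl
  · exact or_comm

theorem reach_swap {p : (V → C) × (V → C)} (n : ℕ) (w : V) :
    Reach E (swap E u p).1 (swap E u p).2 u n w ↔ Reach E p.1 p.2 u n w := by
  induction n generalizing w with
  | zero => rfl
  | succ n ih => simp only [Reach, bad_swap, ih]

/-- Badness is symmetric at each vertex in the two colourings, so exchanging values changes no
component. This makes the exchange an involution. -/
theorem conn_swap {p : (V → C) × (V → C)} (w : V) :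
    Conn E (swap E u p).1 (swap E u p).2 u w ↔ Conn E p.1 p.2 u w :=
  exists_congr fun n => reach_swap n w

theorem swap_swap (p : (V → C) × (V → C)) : swap E u (swap E u p) = p := by
  refine Prod.ext ?_ ?_ <;> funext w
  · change (open Classical in if Conn E (swap E u p).1 (swap E u p).2 u w then _ else _) = _
    rw [conn_swap]
    by_cases h : Conn E p.1 p.2 u w <;> simp [swap, glue, h]
  · change (open Classical in if Conn E (swap E u p).1 (swap E u p).2 u w then _ else _) = _
    rw [conn_swap]
    by_cases h : Conn E p.1 p.2 u w <;> simp [swap, glue, h]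

theorem conn_self : Conn E X Y u u := ⟨0, rfl⟩

theorem Conn.of_bad {e : Finset V} {w y : V} (he : e ∈ E) (hb : Bad X Y e) (hw : w ∈ e)
    (hc : Conn E X Y u w) (hy : y ∈ e) : Conn E X Y u y := by
  obtain ⟨n, hn⟩ := hc
  exact ⟨n + 1, Reach.of_mem he hb hw hn hy⟩

/-- A hyperedge that is monochromatic after gluing is monochromatic before. -/
theorem mono_of_mono_glue {p : (V → C) × (V → C)} {e : Finset V} (he : e ∈ E)
    (h : Mono (glue E u p) e) : Mono p.1 e ∨ Mono p.2 e := by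
  obtain ⟨c, hc⟩ := h
  have hb : Bad p.1 p.2 e := by
    refine ⟨c, fun w hw => ?_⟩
    have := hc w hw
    simp only [glue] at this
    split_ifs at this
    · exact Or.inl this
    · exact Or.inr this
  -- A bad edge lies entirely inside or entirely outside the component of `u`.
  by_cases hx : ∃ w ∈ e, Conn E p.1 p.2 u w
  · obtain ⟨w, hw, hcw⟩ := hx
    refine Or.inl ⟨c, fun y hy => ?_⟩
    have := hc y hy
    rwa [glue, if_pos (Conn.of_bad he hb hw hcw hy)] at this
  · push Not at hx
    refine Or.inr ⟨c, fun y hy => ?_⟩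
    have := hc y hy
    rwa [glue, if_neg (hx y hy)] at this

theorem reach_symm (n : ℕ) (w : V) : Reach E X Y u n w ↔ Reach E Y X u n w := by
  induction n generalizing w with
  | zero => rfl
  | succ n ih =>
    have hb : ∀ e : Finset V, Bad X Y e ↔ Bad Y X e := fun e => by simp only [Bad, or_comm]
    simp only [Reach, hb, ih]

theorem conn_symm (w : V) : Conn E X Y u w ↔ Conn E Y X u w :=
  exists_congr fun n => reach_symm n w

theorem swap_snd (p : (V → C) × (V → C)) : (swap E u p).2 = glue E u (p.2, p.1) := by
  funext w
  simp only [swap, glue]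
  by_cases h : Conn E p.1 p.2 u w
  · rw [if_pos h, if_pos ((conn_symm w).1 h)]
  · rw [if_neg h, if_neg (fun h' => h ((conn_symm w).2 h'))]

/-- The lists disagree only at `u`, which belongs to its own component and so keeps its colour. -/
theorem glue_mem (hLL : ∀ w, w ≠ u → L w = L' w) {p : (V → C) × (V → C)}
    (h1 : p.1 ∈ listColourings E L) (h2 : p.2 ∈ listColourings E L') :
    glue E u p ∈ listColourings E L := by
  rw [mem_listColourings] at h1 h2 ⊢
  refine ⟨fun w => ?_, fun e he hm => ?_⟩
  · simp only [glue]
    split_ifs with h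
    · exact h1.1 w
    · have : w ≠ u := fun hw => h (hw ▸ conn_self)
      rw [hLL w this]
      exact h2.1 w
  · rcases mono_of_mono_glue he hm with h | h
    · exact h1.2 e he h
    · exact h2.2 e he h

theorem swap_mem (hLL : ∀ w, w ≠ u → L w = L' w) {p : (V → C) × (V → C)}
    (h : p ∈ listColourings E L ×ˢ listColourings E L') :
    swap E u p ∈ listColourings E L ×ˢ listColourings E L' := by
  rw [Finset.mem_product] at h ⊢
  refine ⟨glue_mem hLL h.1 h.2, ?_⟩
  rw [swap_snd]
  exact glue_mem (fun w hw => (hLL w hw).symm) h.2 h.1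

-- The exchange is a bijection between the two sets, since it interchanges the colours at every
-- vertex not connected to `u`.
open Classical in
theorem card_not_conn_eq (hLL : ∀ w, w ≠ u → L w = L' w) (P : C → Prop) :
    ((listColourings E L ×ˢ listColourings E L').filter fun p =>
      ¬ Conn E p.1 p.2 u v ∧ P (p.1 v)).card =
    ((listColourings E L ×ˢ listColourings E L').filter fun p =>
      ¬ Conn E p.1 p.2 u v ∧ P (p.2 v)).card := by
  refine Finset.card_bij' (fun p _ => swap E u p) (fun p _ => swap E u p) ?_ ?_
    (fun p _ => swap_swap p) (fun p _ => swap_swap p)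
  · intro p hp
    obtain ⟨hA, hc, hP⟩ := Finset.mem_filter.1 hp
    refine Finset.mem_filter.2 ⟨swap_mem hLL hA, fun h => hc ((conn_swap v).1 h), ?_⟩
    simpa [swap, hc] using hP
  · intro p hp
    obtain ⟨hA, hc, hP⟩ := Finset.mem_filter.1 hp
    refine Finset.mem_filter.2 ⟨swap_mem hLL hA, fun h => hc ((conn_swap v).1 h), ?_⟩
    simpa [swap, glue, hc] using hP

open Classical in
/-- The influence of the list of `u` on the colour class of `v` is bounded by the probability of
being connected by bad edges. -/
theorem sum_abs_marginal_le {D : Type*} [Fintype D] [DecidableEq D] (g : C → D)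
    (hLL : ∀ w, w ≠ u → L w = L' w) (hA : (listColourings E L).Nonempty)
    (hA' : (listColourings E L').Nonempty) (v : V) :
    ∑ j, |(((listColourings E L).filter fun X => g (X v) = j).card : ℝ) /
        (listColourings E L).card -
      (((listColourings E L').filter fun X => g (X v) = j).card : ℝ) /
        (listColourings E L').card| ≤
    2 * ((((listColourings E L ×ˢ listColourings E L').filter fun p =>
      Conn E p.1 p.2 u v).card : ℝ) /
        ((listColourings E L).card * (listColourings E L').card)) := by
  set A := listColourings E L with hAdef
  set A' := listColourings E L' with hAdef'
  have ha : (0 : ℝ) < A.card := Nat.cast_pos.2 hA.card_pos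
  have ha' : (0 : ℝ) < A'.card := Nat.cast_pos.2 hA'.card_pos
  have hterm : ∀ j, |((A.filter fun X => g (X v) = j).card : ℝ) / A.card -
      ((A'.filter fun X => g (X v) = j).card : ℝ) / A'.card| ≤
      ((((A ×ˢ A').filter fun p => Conn E p.1 p.2 u v ∧ g (p.1 v) = j).card : ℝ) +
      (((A ×ˢ A').filter fun p => Conn E p.1 p.2 u v ∧ g (p.2 v) = j).card : ℝ)) /
        (A.card * A'.card) := by
    intro j
    have e1 : ((A ×ˢ A').filter fun p => g (p.1 v) = j).card =
        (A.filter fun X => g (X v) = j).card * A'.card := by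
      rw [← Finset.card_product]
      congr 1
      ext p
      simp only [Finset.mem_filter, Finset.mem_product]
      tauto
    have e2 : ((A ×ˢ A').filter fun p => g (p.2 v) = j).card =
        A.card * (A'.filter fun X => g (X v) = j).card := by
      rw [← Finset.card_product]
      congr 1
      ext p
      simp only [Finset.mem_filter, Finset.mem_product]
      tauto
    have s1 := Finset.card_filter_add_card_filter_not (s := (A ×ˢ A').filter fun p => g (p.1 v) = j)
      (fun p => Conn E p.1 p.2 u v)
    have s2 := Finset.card_filter_add_card_filter_not (s := (A ×ˢ A').filter fun p => g (p.2 v) = j)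
      (fun p => Conn E p.1 p.2 u v)
    have hn := card_not_conn_eq (E := E) (v := v) hLL (fun c => g c = j)
    simp only [Finset.filter_filter, ← hAdef, ← hAdef'] at s1 s2 hn
    simp only [and_comm (b := Conn E _ _ u v), and_comm (b := ¬ Conn E _ _ u v)] at s1 s2
    rw [e1] at s1
    rw [e2] at s2
    have s1' := congrArg (Nat.cast : ℕ → ℝ) s1
    have s2' := congrArg (Nat.cast : ℕ → ℝ) s2
    rw [Nat.cast_add, Nat.cast_mul] at s1' s2'
    rw [div_sub_div _ _ ha.ne' ha'.ne', abs_div, abs_of_pos (mul_pos ha ha'), ← s1', ← s2']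
    refine div_le_div_of_nonneg_right ?_ (mul_pos ha ha').le
    -- The unconnected pairs `b` and `d` cancel; only the connected pairs `a` and `c` remain.
    have key : ∀ a b c d : ℝ, b = d → 0 ≤ a → 0 ≤ c → |a + b - (c + d)| ≤ a + c := by
      intro a b c d hbd ha hc
      rw [abs_le]
      constructor <;> linarith
    refine (key _ _ _ _ (congrArg Nat.cast ?_) (Nat.cast_nonneg _) (Nat.cast_nonneg _)).trans_eq ?_
    · convert hn
    · congr!
  refine (Finset.sum_le_sum fun j _ => hterm j).trans ?_
  rw [← Finset.sum_div, Finset.sum_add_distrib, ← mul_div_assoc]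
  refine div_le_div_of_nonneg_right ?_ (mul_pos ha ha').le
  have f1 : ∀ f : (V → C) × (V → C) → D,
      ∑ j, (((A ×ˢ A').filter fun p => Conn E p.1 p.2 u v ∧ f p = j).card : ℝ) =
      (((A ×ˢ A').filter fun p => Conn E p.1 p.2 u v).card : ℝ) := by
    intro f
    rw [← Nat.cast_sum]
    congr 1
    simp only [← Finset.filter_filter]
    exact (Finset.card_eq_sum_card_fiberwise
      (fun x _ => Finset.mem_coe.2 (Finset.mem_univ (f x)))).symm
  rw [f1 fun p => g (p.1 v), f1 fun p => g (p.2 v)]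
  linarith

end Percolation

/-! ### Products of transition matrices -/

section MultiStep

variable {Ω : Type*} [Fintype Ω] [DecidableEq Ω] {P : ℕ → Matrix Ω Ω ℝ}

theorem multiStep_add (r a b : ℕ) :
    multiStep P r (a + b) = multiStep P r a * multiStep P (r + a) b := by
  induction b with
  | zero => simp [multiStep]
  | succ b ih =>
    rw [← Nat.add_assoc]
    simp only [multiStep]
    rw [ih, Matrix.mul_assoc, ← Nat.add_assoc]

theorem multiStep_one (r : ℕ) : multiStep P r 1 = P (r + 1) := by
  simp [multiStep]

theorem multiStep_nonneg (hP : ∀ t X Y, 0 ≤ P t X Y) (r t : ℕ) (X Y : Ω) :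
    0 ≤ multiStep P r t X Y := by
  induction t generalizing Y with
  | zero =>
    simp only [multiStep, Matrix.one_apply]
    split_ifs <;> norm_num
  | succ t ih =>
    simp only [multiStep, Matrix.mul_apply]
    exact Finset.sum_nonneg fun Z _ => mul_nonneg (ih Z) (hP _ _ _)

theorem multiStep_succ_pos (hP : ∀ t X Y, 0 ≤ P t X Y) {r t : ℕ} {X Y Z : Ω}
    (h1 : 0 < multiStep P r t X Y) (h2 : 0 < P (r + t + 1) Y Z) :
    0 < multiStep P r (t + 1) X Z := by
  simp only [multiStep, Matrix.mul_apply]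
  exact Finset.sum_pos' (fun W _ => mul_nonneg (multiStep_nonneg hP r t X W) (hP _ _ _))
    ⟨Y, Finset.mem_univ _, mul_pos h1 h2⟩

theorem vecMul_multiStep {π : Ω → ℝ} (hP : ∀ t, Matrix.vecMul π (P t) = π) (r t : ℕ) :
    Matrix.vecMul π (multiStep P r t) = π := by
  induction t with
  | zero => simp [multiStep]
  | succ t ih => rw [multiStep, ← Matrix.vecMul_vecMul, ih, hP]

theorem isAperiodic_of_pos (hP : ∀ t X, 0 < P t X X) : IsAperiodic P := by
  intro r X d h
  have := h 1 (by rw [multiStep_one]; exact hP _ _)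
  exact Nat.dvd_one.1 this

end MultiStep

/-! ### Heat-bath updates, oscillations and contraction over a sweep -/

section HeatBath

set_option linter.unusedSectionVars false

variable {V : Type*} [Fintype V] [DecidableEq V] {s : ℕ} {ν : (V → Fin s) → ℝ}

theorem sum_update_pos (hν : ∀ τ, 0 < ν τ) (v : V) (X : V → Fin s) :
    0 < ∑ c, ν (Function.update X v c) :=
  Finset.sum_pos (fun _ _ => hν _) ⟨X v, Finset.mem_univ _⟩

theorem condMarginal_pos (hν : ∀ τ, 0 < ν τ) (v : V) (X : V → Fin s) (c : Fin s) :
    0 < condMarginal ν v X c :=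
  div_pos (hν _) (sum_update_pos hν v X)

theorem sum_condMarginal (hν : ∀ τ, 0 < ν τ) (v : V) (X : V → Fin s) :
    ∑ c, condMarginal ν v X c = 1 := by
  simp only [condMarginal]
  rw [← Finset.sum_div, div_self (sum_update_pos hν v X).ne']

theorem eq_update_of_agree {v : V} {X Y : V → Fin s} (h : ∀ u, u ≠ v → Y u = X u) :
    Y = Function.update X v (Y v) := by
  funext u
  by_cases hu : u = v
  · subst hu; simp
  · simp [hu, h u hu]

theorem update_eq_of_agree {v : V} {X Y : V → Fin s} (h : ∀ u, u ≠ v → Y u = X u) (c : Fin s) :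
    Function.update Y v c = Function.update X v c := by
  rw [eq_update_of_agree h, Function.update_idem]

theorem condMarginal_congr {v : V} {X Y : V → Fin s} (h : ∀ u, u ≠ v → Y u = X u) (c : Fin s) :
    condMarginal ν v Y c = condMarginal ν v X c := by
  simp only [condMarginal, update_eq_of_agree h]

theorem heatBath_nonneg (hν : ∀ τ, 0 < ν τ) (v : V) (X Y : V → Fin s) :
    0 ≤ heatBath ν v X Y := by
  simp only [heatBath, Matrix.of_apply]
  split_ifs
  · exact (condMarginal_pos hν _ _ _).le
  · exact le_rfl

theorem heatBath_pos (hν : ∀ τ, 0 < ν τ) {v : V} {X Y : V → Fin s}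
    (h : ∀ u, u ≠ v → Y u = X u) : 0 < heatBath ν v X Y := by
  simp only [heatBath, Matrix.of_apply, if_pos h]
  exact condMarginal_pos hν _ _ _

theorem heatBath_reversible (v : V) (X Y : V → Fin s) :
    ν X * heatBath ν v X Y = ν Y * heatBath ν v Y X := by
  simp only [heatBath, Matrix.of_apply]
  by_cases h : ∀ u, u ≠ v → Y u = X u
  · have h' : ∀ u, u ≠ v → X u = Y u := fun u hu => (h u hu).symm
    rw [if_pos h, if_pos h', condMarginal_congr h]
    simp only [condMarginal]
    rw [← eq_update_of_agree h, Function.update_eq_self]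
    ring
  · rw [if_neg h, if_neg fun h' => h fun u hu => (h' u hu).symm]
    simp

theorem heatBath_mulVec (v : V) (f : (V → Fin s) → ℝ) (X : V → Fin s) :
    (heatBath ν v).mulVec f X = ∑ c, condMarginal ν v X c * f (Function.update X v c) := by
  simp only [Matrix.mulVec, dotProduct, heatBath, Matrix.of_apply, ite_mul, zero_mul]
  rw [← Finset.sum_filter]
  refine Finset.sum_bij' (fun Y _ => Y v) (fun c _ => Function.update X v c) ?_ ?_ ?_ ?_ ?_
  · exact fun _ _ => Finset.mem_univ _
  · intro c _
    refine Finset.mem_filter.2 ⟨Finset.mem_univ _, fun u hu => ?_⟩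
    simp [hu]
  · exact fun Y hY => (eq_update_of_agree (Finset.mem_filter.1 hY).2).symm
  · intro c _; simp
  · intro Y hY
    rw [← eq_update_of_agree (Finset.mem_filter.1 hY).2]

theorem vecMul_heatBath (hν : ∀ τ, 0 < ν τ) (v : V) : Matrix.vecMul ν (heatBath ν v) = ν := by
  funext Y
  have h := heatBath_mulVec (ν := ν) v (fun _ => 1) Y
  simp only [mul_one, sum_condMarginal hν] at h
  simp only [Matrix.mulVec, dotProduct, mul_one] at h
  simp only [Matrix.vecMul, dotProduct]
  rw [Finset.sum_congr rfl fun X _ => heatBath_reversible v X Y, ← Finset.mul_sum, h, mul_one]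

/-- Changing the coordinate `u` changes `f` by at most `d u`. -/
def HasOsc (f : (V → Fin s) → ℝ) (d : V → ℝ) : Prop :=
  ∀ u X Y, (∀ w, w ≠ u → X w = Y w) → |f X - f Y| ≤ d u

theorem HasOsc.abs_sub_le {f : (V → Fin s) → ℝ} {d : V → ℝ} (hf : HasOsc f d)
    (X Y : V → Fin s) : |f X - f Y| ≤ ∑ u, d u := by
  have key : ∀ S : Finset V, |f X - f (S.piecewise Y X)| ≤ ∑ u ∈ S, d u := by
    intro S
    induction S using Finset.induction_on with
    | empty => simp
    | insert v S hv ih =>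
      rw [Finset.sum_insert hv, add_comm]
      refine (_root_.abs_sub_le _ (f (S.piecewise Y X)) _).trans (add_le_add ih (hf v _ _ ?_))
      intro w hw
      simp [Finset.piecewise, hw]
  simpa using key Finset.univ

/-- Resampling `v` erases the dependence on `v`. A change at another `u` acts directly, at cost `d
u`, and by shifting the law of the new value at `v`, at cost `R v u * d v`. -/
theorem HasOsc.heatBath {f : (V → Fin s) → ℝ} {d : V → ℝ} {R : V → V → ℝ} {v : V}
    (hν : ∀ τ, 0 < ν τ)
    (hR : ∀ u, u ≠ v → ∀ X Y : V → Fin s, (∀ w, w ≠ u → X w = Y w) →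
      ∑ c, |condMarginal ν v X c - condMarginal ν v Y c| ≤ R v u)
    (hd : ∀ u, 0 ≤ d u) (hf : HasOsc f d) :
    HasOsc ((heatBath ν v).mulVec f) fun u => if u = v then 0 else d u + R v u * d v := by
  intro u X Y hXY
  simp only [heatBath_mulVec]
  by_cases hu : u = v
  · subst hu
    rw [if_pos rfl]
    simp only [condMarginal_congr hXY, update_eq_of_agree hXY, sub_self, abs_zero, le_refl]
  · rw [if_neg hu]
    have h1 : ∑ c, condMarginal ν v X c * f (Function.update X v c) -
        ∑ c, condMarginal ν v Y c * f (Function.update Y v c) =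
        ∑ c, condMarginal ν v X c * (f (Function.update X v c) - f (Function.update Y v c)) +
        ∑ c, (condMarginal ν v X c - condMarginal ν v Y c) *
          (f (Function.update Y v c) - f Y) := by
      -- Both laws have mass 1, so the constant `f Y` can be subtracted, leaving an oscillation at
      -- `v` alone.
      have h2 : ∑ c, (condMarginal ν v X c - condMarginal ν v Y c) * f Y = 0 := by
        rw [← Finset.sum_mul, Finset.sum_sub_distrib, sum_condMarginal hν, sum_condMarginal hν]
        simp
      simp only [sub_mul, mul_sub, Finset.sum_sub_distrib] at h2 ⊢
      linarith
    rw [h1]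
    refine (abs_add_le _ _).trans (add_le_add ?_ ?_)
    · refine (Finset.abs_sum_le_sum_abs _ _).trans ?_
      have h3 : ∀ c, |condMarginal ν v X c *
          (f (Function.update X v c) - f (Function.update Y v c))| ≤
          condMarginal ν v X c * d u := by
        intro c
        rw [abs_mul, abs_of_pos (condMarginal_pos hν _ _ _)]
        refine mul_le_mul_of_nonneg_left (hf u _ _ fun w hw => ?_) (condMarginal_pos hν _ _ _).le
        by_cases hwv : w = v
        · subst hwv; simp
        · simp [hwv, hXY w hw]
      refine (Finset.sum_le_sum fun c _ => h3 c).trans_eq ?_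
      rw [← Finset.sum_mul, sum_condMarginal hν, one_mul]
    · refine (Finset.abs_sum_le_sum_abs _ _).trans ?_
      refine le_trans ?_ (mul_le_mul_of_nonneg_right (hR u hu X Y hXY) (hd v))
      rw [Finset.sum_mul]
      refine Finset.sum_le_sum fun c _ => ?_
      rw [abs_mul]
      refine mul_le_mul_of_nonneg_left (hf v _ _ fun w hw => ?_) (abs_nonneg _)
      simp [hw]

/-- Potential argument with weight 2 on processed vertices and 1 on the others. Processing `v`
removes `d v` and creates at most `d v / 2` of new oscillation, of weight at most 2. The doubled
weight of `v` costs nothing because its oscillation is now zero. -/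
theorem sum_weight_step_le {d : V → ℝ} {R : V → V → ℝ} {v : V} (hR0 : ∀ u, 0 ≤ R v u)
    (hR : ∑ u, R v u ≤ 1 / 2) (hd : ∀ u, 0 ≤ d u) (S : Finset V) (hv : v ∉ S) :
    ∑ u, (if u ∈ insert v S then 2 else 1) * (if u = v then 0 else d u + R v u * d v) ≤
      ∑ u, (if u ∈ S then 2 else 1 : ℝ) * d u := by
  have h1 : ∀ u, (if u ∈ insert v S then 2 else 1 : ℝ) *
      (if u = v then 0 else d u + R v u * d v) ≤
      (if u ∈ S then 2 else 1) * d u - (if u = v then d v else 0) + 2 * (R v u * d v) := by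
    intro u
    have h0 := mul_nonneg (hR0 u) (hd v)
    by_cases huv : u = v
    · subst huv
      simp [hv, h0]
    · by_cases hS : u ∈ S
      · simp only [Finset.mem_insert, hS, huv, or_true, if_true, if_false]
        linarith
      · simp only [Finset.mem_insert, hS, huv, or_self, if_false]
        linarith
  refine (Finset.sum_le_sum fun u _ => h1 u).trans ?_
  rw [Finset.sum_add_distrib, Finset.sum_sub_distrib, Finset.sum_ite_eq' Finset.univ v,
    ← Finset.mul_sum, ← Finset.sum_mul, if_pos (Finset.mem_univ v)]
  have := mul_le_mul_of_nonneg_right hR (hd v)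
  linarith

variable {R : V → V → ℝ} {vtx : ℕ → V}

/-- `S` holds the vertices already processed, which are those updated later in time, since test
functions evolve backwards. Over a full sweep the weights rise from 1 to 2 everywhere while the
potential does not grow, so the total oscillation halves. -/
theorem HasOsc.multiStep_window (hν : ∀ τ, 0 < ν τ)
    (hR : ∀ v u, u ≠ v → ∀ X Y : V → Fin s, (∀ w, w ≠ u → X w = Y w) →
      ∑ c, |condMarginal ν v X c - condMarginal ν v Y c| ≤ R v u)
    (hR0 : ∀ v u, 0 ≤ R v u) (hRs : ∀ v, ∑ u, R v u ≤ 1 / 2) (r j : ℕ)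
    (hinj : Set.InjOn vtx (Set.Ioc r (r + j))) {f : (V → Fin s) → ℝ} {d : V → ℝ} (S : Finset V)
    (hS : ∀ i ∈ Set.Ioc r (r + j), vtx i ∉ S) (hd : ∀ u, 0 ≤ d u) (hf : HasOsc f d)
    (W : Finset V) (hW : ∀ u ∈ W, u ∈ S ∨ ∃ i ∈ Set.Ioc r (r + j), vtx i = u) :
    ∃ d' : V → ℝ, (∀ u, 0 ≤ d' u) ∧
      HasOsc ((multiStep (fun t => BucketScan.heatBath ν (vtx t)) r j).mulVec f) d' ∧
      ∑ u, (if u ∈ W then 2 else 1 : ℝ) * d' u ≤ ∑ u, (if u ∈ S then 2 else 1 : ℝ) * d u := by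
  induction j generalizing f d S with
  | zero =>
    refine ⟨d, hd, by simpa [multiStep] using hf, Finset.sum_le_sum fun u _ =>
      mul_le_mul_of_nonneg_right ?_ (hd u)⟩
    by_cases hu : u ∈ W
    · rcases hW u hu with h | ⟨i, hi, _⟩
      · simp [hu, h]
      · simp at hi
    · rw [if_neg hu]
      split_ifs <;> norm_num
  | succ j ih =>
    have hmem : r + j + 1 ∈ Set.Ioc r (r + (j + 1)) := ⟨by omega, by omega⟩
    have hsub : Set.Ioc r (r + j) ⊆ Set.Ioc r (r + (j + 1)) :=
      Set.Ioc_subset_Ioc_right (by omega)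
    -- The last update in time is the first to act on `f`.
    have hstep := HasOsc.heatBath (v := vtx (r + j + 1)) hν (hR _) hd hf
    obtain ⟨d', hd', hf', hle⟩ := ih (hinj.mono hsub) (insert (vtx (r + j + 1)) S)
      (by
        intro i hi hiS
        rcases Finset.mem_insert.1 hiS with h | h
        · have := hinj (hsub hi) hmem h
          have := hi.2
          omega
        · exact hS i (hsub hi) h)
      (by
        intro u
        split_ifs
        · exact le_rfl
        · exact add_nonneg (hd u) (mul_nonneg (hR0 _ _) (hd _)))
      hstep
      (by
        intro u hu
        rcases hW u hu with h | ⟨i, hi, h⟩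
        · exact Or.inl (Finset.mem_insert_of_mem h)
        · by_cases hij : i = r + j + 1
          · subst hij
            exact Or.inl (h ▸ Finset.mem_insert_self _ _)
          · exact Or.inr ⟨i, ⟨hi.1, by have := hi.2; omega⟩, h⟩)
    refine ⟨d', hd', ?_, hle.trans (sum_weight_step_le (hR0 _) (hRs _) hd S (hS _ hmem))⟩
    rw [multiStep, ← Matrix.mulVec_mulVec]
    exact hf'

/-- `m` sweeps, preceded by a partial one, shrink the total oscillation by the factor `2 ^ m`. -/
theorem HasOsc.multiStep_sweeps (hν : ∀ τ, 0 < ν τ)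
    (hR : ∀ v u, u ≠ v → ∀ X Y : V → Fin s, (∀ w, w ≠ u → X w = Y w) →
      ∑ c, |condMarginal ν v X c - condMarginal ν v Y c| ≤ R v u)
    (hR0 : ∀ v u, 0 ≤ R v u) (hRs : ∀ v, ∑ u, R v u ≤ 1 / 2) {n : ℕ}
    (hinj : ∀ r, Set.InjOn vtx (Set.Ioc r (r + n)))
    (hsurj : ∀ r u, ∃ i ∈ Set.Ioc r (r + n), vtx i = u) {a : ℕ} (ha : a ≤ n) (m : ℕ)
    {f : (V → Fin s) → ℝ} {d : V → ℝ} (hd : ∀ u, 0 ≤ d u) (hf : HasOsc f d) :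
    ∃ d' : V → ℝ, HasOsc
        ((multiStep (fun t => BucketScan.heatBath ν (vtx t)) 0 (a + m * n)).mulVec f) d' ∧
      2 ^ m * ∑ u, d' u ≤ ∑ u, d u := by
  induction m generalizing f d with
  | zero =>
    -- With `W = ∅` all final weights are 1: a partial sweep does not increase the total
    -- oscillation.
    obtain ⟨d', _, hf', hle⟩ := HasOsc.multiStep_window hν hR hR0 hRs 0 a
      ((hinj 0).mono (Set.Ioc_subset_Ioc_right (by omega))) ∅ (by simp) hd hf ∅ (by simp)
    exact ⟨d', by simpa using hf', by simpa using hle⟩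
  | succ m ih =>
    obtain ⟨d₁, hd₁, hf₁, hle₁⟩ := HasOsc.multiStep_window hν hR hR0 hRs (0 + (a + m * n)) n
      (hinj _) ∅ (by simp) hd hf Finset.univ (fun u _ => Or.inr (hsurj _ u))
    obtain ⟨d', hf', hle⟩ := ih hd₁ hf₁
    refine ⟨d', ?_, ?_⟩
    · rw [Nat.succ_mul, ← Nat.add_assoc, multiStep_add, ← Matrix.mulVec_mulVec]
      exact hf'
    · simp only [Finset.mem_univ, if_true, Finset.notMem_empty, if_false, one_mul,
        ← Finset.mul_sum] at hle₁
      rw [pow_succ']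
      linarith

/-- Total variation is attained by a test function with values ±1/2. By stationarity it is a
`ν`-average of differences of `M.mulVec f`, each at most its total oscillation. -/
theorem tvDist_le_of_hasOsc (hν : ∀ τ, 0 < ν τ) (hν1 : ∑ τ, ν τ = 1)
    {M : Matrix (V → Fin s) (V → Fin s) ℝ} (hM : Matrix.vecMul ν M = ν) {B : ℝ}
    (hB : ∀ f : (V → Fin s) → ℝ, HasOsc f (fun _ => 1) →
      ∃ d : V → ℝ, HasOsc (M.mulVec f) d ∧ ∑ u, d u ≤ B) (X : V → Fin s) :
    tvDist (fun Y => M X Y) ν ≤ B := by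
  set f : (V → Fin s) → ℝ := fun Y => if ν Y ≤ M X Y then 1 / 2 else -1 / 2 with hf
  obtain ⟨d, hd, hdB⟩ := hB f (by
    intro u Y Z _
    simp only [hf]
    split_ifs <;> norm_num)
  have h1 : tvDist (fun Y => M X Y) ν = M.mulVec f X - ∑ Y, ν Y * f Y := by
    simp only [tvDist, Matrix.mulVec, dotProduct]
    rw [Finset.mul_sum, ← Finset.sum_sub_distrib]
    refine Finset.sum_congr rfl fun Y _ => ?_
    simp only [hf]
    split_ifs with h
    · rw [abs_of_nonneg (by linarith)]; ring
    · rw [abs_of_neg (by linarith)]; ring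
  have h2 : ∑ Y, ν Y * f Y = ∑ Z, ν Z * M.mulVec f Z := by
    have := Matrix.dotProduct_mulVec ν M f
    rw [hM] at this
    exact this.symm
  have h3 : M.mulVec f X = ∑ Z, ν Z * M.mulVec f X := by
    rw [← Finset.sum_mul, hν1, one_mul]
  rw [h1, h2, h3, ← Finset.sum_sub_distrib]
  calc ∑ Z, (ν Z * M.mulVec f X - ν Z * M.mulVec f Z)
      ≤ ∑ Z, ν Z * B := by
        refine Finset.sum_le_sum fun Z _ => ?_
        rw [← mul_sub]
        exact mul_le_mul_of_nonneg_left
          ((le_abs_self _).trans ((hd.abs_sub_le X Z).trans hdB)) (hν Z).le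
    _ = B := by rw [← Finset.sum_mul, hν1, one_mul]

/-- If every vertex is updated in every window of `n` steps, then every transition matrix of
`n` steps is positive. -/
theorem multiStep_pos (hν : ∀ τ, 0 < ν τ) {n : ℕ}
    (hsurj : ∀ r u, ∃ i ∈ Set.Ioc r (r + n), vtx i = u) (r : ℕ) (X Y : V → Fin s) :
    0 < multiStep (fun t => BucketScan.heatBath ν (vtx t)) r n X Y := by
  classical
  -- Each updated vertex is set to its target value in `Y`, which has positive probability at every
  -- step.
  have key : ∀ t, 0 < multiStep (fun t => BucketScan.heatBath ν (vtx t)) r t X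
      fun u => if ∃ i ∈ Set.Ioc r (r + t), vtx i = u then Y u else X u := by
    intro t
    induction t with
    | zero =>
      have h0 : (fun u => if ∃ i ∈ Set.Ioc r (r + 0), vtx i = u then Y u else X u) = X := by
        funext u
        simp
      rw [h0]
      simp [multiStep]
    | succ t ih =>
      refine multiStep_succ_pos (fun _ => heatBath_nonneg hν _) ih (heatBath_pos hν ?_)
      intro u hu
      have : (∃ i ∈ Set.Ioc r (r + (t + 1)), vtx i = u) ↔ ∃ i ∈ Set.Ioc r (r + t), vtx i = u := by
        constructor
        · rintro ⟨i, hi, h⟩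
          refine ⟨i, ⟨hi.1, ?_⟩, h⟩
          have h2 := hi.2
          have : i ≠ r + t + 1 := fun h' => hu (by rw [← h, h'])
          omega
        · rintro ⟨i, hi, h⟩
          exact ⟨i, ⟨hi.1, by have := hi.2; omega⟩, h⟩
      simp only [this]
  have h := key n
  simpa only [hsurj r, if_true] using h

end HeatBath

/-! ### Numerical estimates -/

section Numerics

theorem numBuckets_bounds {q : ℕ} (hq : 40 ≤ q) :
    (q : ℝ) ≤ (numBuckets q : ℝ) ^ 2 ∧ 7 ≤ numBuckets q ∧
      numBuckets q - 2 ≤ ⌊(q : ℝ) / numBuckets q⌋₊ := by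
  set s := numBuckets q with hs
  have h0 : Real.sqrt q ≤ s := Nat.le_ceil _
  have h1 : (s : ℝ) < Real.sqrt q + 1 := Nat.ceil_lt_add_one (Real.sqrt_nonneg _)
  have h2 : Real.sqrt q ^ 2 = q := Real.sq_sqrt (Nat.cast_nonneg q)
  have h3 : (q : ℝ) ≤ (s : ℝ) ^ 2 := h2 ▸ pow_le_pow_left₀ (Real.sqrt_nonneg _) h0 2
  have h4 : 7 ≤ s := by
    by_contra h
    have h5 : s ^ 2 ≤ 6 ^ 2 := Nat.pow_le_pow_left (by omega) 2
    have h6 : q ≤ s ^ 2 := by exact_mod_cast h3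
    omega
  refine ⟨h3, h4, Nat.le_floor ?_⟩
  have h7 : (7 : ℝ) ≤ s := by exact_mod_cast h4
  rw [Nat.cast_sub (by omega), le_div_iff₀ (by linarith), ← h2]
  push_cast
  nlinarith

theorem mul_half_pow_le {k : ℕ} (hk : 20 ≤ k) : (k : ℝ) * (1 / 2) ^ (k - 4) ≤ 1 / 25 := by
  have h : 25 * k ≤ 2 ^ (k - 4) := by
    induction k, hk using Nat.le_induction with
    | base => norm_num
    | succ k hk ih =>
      rw [show k + 1 - 4 = k - 4 + 1 by omega, pow_succ]
      omega
  have h' : (25 * k : ℝ) ≤ 2 ^ (k - 4) := by exact_mod_cast h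
  rw [one_div, inv_pow, ← div_eq_mul_inv, div_le_iff₀ (by positivity)]
  linarith

/-- The numerical conditions under which the counting and the percolation arguments apply. -/
theorem numerical_bounds {k Δ q : ℕ} (hΔ : 1 ≤ Δ) (hk : 20 ≤ k)
    (hq : 40 * (Δ : ℝ) ^ ((2 : ℝ) / ((k : ℝ) - 4)) ≤ (q : ℝ)) :
    40 ≤ q ∧ ∃ β : ℝ, 0 < β ∧
      β + Δ / β ^ (k - 2) ≤ ⌊(q : ℝ) / numBuckets q⌋₊ ∧
      Δ * (k * (q * (2 / β) ^ (k - 1))) ≤ (1 / 5 : ℝ) := by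
  have hk4 : ((k - 4 : ℕ) : ℝ) = (k : ℝ) - 4 := by rw [Nat.cast_sub (by omega)]; norm_num
  have hΔ' : (1 : ℝ) ≤ Δ := by exact_mod_cast hΔ
  set x : ℝ := (Δ : ℝ) ^ ((1 : ℝ) / ((k : ℝ) - 4)) with hx
  have hx1 : 1 ≤ x := Real.one_le_rpow hΔ' (by rw [← hk4]; positivity)
  have hxk : x ^ (k - 4) = Δ := by
    rw [hx, ← hk4, one_div]
    exact Real.rpow_inv_natCast_pow (by positivity) (by omega)
  have hx2 : (Δ : ℝ) ^ ((2 : ℝ) / ((k : ℝ) - 4)) = x ^ 2 := by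
    rw [hx, ← Real.rpow_natCast, ← Real.rpow_mul (by positivity)]
    congr 1
    push_cast
    ring
  rw [hx2] at hq
  have hq40 : 40 ≤ q := by
    have : (40 : ℝ) ≤ q := by nlinarith
    exact_mod_cast this
  obtain ⟨hs2, hs7, hm⟩ := numBuckets_bounds hq40
  set s := numBuckets q
  set m := ⌊(q : ℝ) / s⌋₊
  have hs7' : (7 : ℝ) ≤ s := by exact_mod_cast hs7
  have hm' : (s : ℝ) ≤ m + 2 := by
    have : s ≤ m + 2 := by omega
    exact_mod_cast this
  -- Here `m` is the least possible bucket size. The reserved `m / 10`, at least 1/2, pays for `Δ /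
  -- β ^ (k - 2)`, at most 1/4.
  set β : ℝ := 9 / 10 * m with hβ
  -- From `s ≥ 7`, `m ≥ s - 2 ≥ 5s/7`. Below, `4 * x ≤ β` follows because (9/14)²·40 exceeds 16.
  have hβs : 9 / 14 * s ≤ β := by linarith
  have hβ0 : 0 < β := by linarith
  have hβx : 4 * x ≤ β := by
    refine le_of_sq_le_sq ?_ hβ0.le
    have := pow_le_pow_left₀ (by positivity) hβs 2
    nlinarith
  refine ⟨hq40, β, hβ0, ?_, ?_⟩
  · have h1 : (Δ : ℝ) ≤ β ^ (k - 4) := by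
      rw [← hxk]
      exact pow_le_pow_left₀ (by linarith) (by linarith) _
    have h2 : Δ / β ^ (k - 2) ≤ 1 / 4 := by
      rw [show k - 2 = k - 4 + 2 by omega, pow_add, div_le_iff₀ (by positivity)]
      have h3 : (4 : ℝ) ≤ β ^ 2 := by nlinarith
      have := mul_le_mul h1 h3 (by norm_num) (by positivity)
      linarith
    linarith
  · have h1 : (Δ : ℝ) * (2 / β) ^ (k - 4) ≤ (1 / 2) ^ (k - 4) := by
      rw [← hxk, ← mul_pow]
      refine pow_le_pow_left₀ (by positivity) ?_ _
      rw [mul_div_assoc', div_le_iff₀ hβ0]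
      linarith
    -- Of the `k - 1` factors `2 / β`, `k - 4` absorb Δ and three absorb the choice of colour, as `q
    -- ≤ s ^ 2` and β is of order `s`.
    have h2 : (q : ℝ) * (2 / β) ^ 3 ≤ 5 := by
      rw [div_pow, mul_div_assoc', div_le_iff₀ (by positivity)]
      have h3 := pow_le_pow_left₀ (by positivity) hβs 3
      have h4 : (7 : ℝ) * s ^ 2 ≤ s ^ 3 := by
        rw [pow_succ (s : ℝ) 2, mul_comm]
        exact mul_le_mul_of_nonneg_left hs7' (by positivity)
      nlinarith
    have h3 := mul_half_pow_le hk
    calc (Δ : ℝ) * (k * (q * (2 / β) ^ (k - 1)))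
        = k * (Δ * (2 / β) ^ (k - 4)) * (q * (2 / β) ^ 3) := by
          rw [show k - 1 = k - 4 + 3 by omega, pow_add]
          ring
      _ ≤ k * (1 / 2) ^ (k - 4) * 5 := by gcongr
      _ ≤ 1 / 5 := by linarith

theorem sum_pow_succ_le {γ : ℝ} (h0 : 0 ≤ γ) (h : γ ≤ 1 / 5) (N : ℕ) :
    ∑ n ∈ Finset.range N, γ ^ (n + 1) ≤ 1 / 4 := by
  have h1 : ∀ n ∈ Finset.range N, γ ^ (n + 1) ≤ 1 / 5 * (1 / 5) ^ n := by
    intro n _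
    rw [← pow_succ']
    exact pow_le_pow_left₀ h0 h _
  refine (Finset.sum_le_sum h1).trans ?_
  rw [← Finset.mul_sum, geom_sum_eq (by norm_num)]
  have h2 : ((1 / 5 : ℝ) ^ N - 1) / (1 / 5 - 1) = (1 - (1 / 5) ^ N) * (5 / 4) := by ring
  have h3 : (0 : ℝ) ≤ (1 / 5) ^ N := by positivity
  rw [h2]
  linarith

theorem sweeps_suffice {n Δ : ℕ} (hn : 2 ≤ n) (hΔ : 1 ≤ Δ) {ε : ℝ} (hε : 0 < ε) (hε1 : ε < 1) :
    (n : ℝ) / 2 ^ (⌈50 * (n : ℝ) * Real.log ((n : ℝ) * (Δ : ℝ) / ε)⌉₊ / n) < ε := by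
  set y : ℝ := (n : ℝ) * Δ / ε with hy
  set T := ⌈50 * (n : ℝ) * Real.log y⌉₊ with hT
  set m := T / n with hm
  have hn' : (2 : ℝ) ≤ n := by exact_mod_cast hn
  have hΔ' : (1 : ℝ) ≤ Δ := by exact_mod_cast hΔ
  have hny : (n : ℝ) ≤ ε * y := by
    rw [hy, mul_div_cancel₀ _ hε.ne']
    nlinarith
  have hy2 : 2 ≤ y := by nlinarith
  have h1 : (T : ℝ) ≤ (m + 1) * n := by
    have : T ≤ (m + 1) * n := by
      have h1 := Nat.div_add_mod T n
      have h2 := Nat.mod_lt T (by omega : 0 < n)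
      rw [add_mul, one_mul, mul_comm m n, hm]
      omega
    exact_mod_cast this
  have h2 : 50 * (n : ℝ) * Real.log y ≤ (m + 1) * n := (Nat.le_ceil _).trans h1
  have h3 : 50 * Real.log y ≤ m + 1 := by
    have : (50 * Real.log y) * n ≤ (m + 1) * n := by linarith
    exact le_of_mul_le_mul_right this (by linarith)
  have hlog2 : 1 / 2 ≤ Real.log 2 := by linarith [Real.log_two_gt_d9]
  -- Half of 50, since log 2 ≥ 1/2. The surplus `y ^ 24` easily absorbs the unfinished sweep and
  -- gives strictness.
  have h4 : y ^ 25 ≤ 2 ^ (m + 1) := by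
    rw [← Real.log_le_log_iff (by positivity) (by positivity), Real.log_pow, Real.log_pow]
    push_cast
    nlinarith
  have h5 : (2 : ℝ) ^ 24 ≤ y ^ 24 := pow_le_pow_left₀ (by norm_num) hy2 24
  have h6 : 4 * y ≤ 2 ^ (m + 1) := by
    refine le_trans ?_ h4
    rw [pow_succ]
    refine mul_le_mul_of_nonneg_right (le_trans (by norm_num) h5) (by linarith)
  rw [pow_succ] at h6
  rw [div_lt_iff₀ (by positivity)]
  nlinarith

end Numerics

/-! ### The projected distribution as a count of list colourings -/

section Projection

set_option linter.unusedSectionVars false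

variable {V : Type*} [Fintype V] [DecidableEq V]

open Classical in
/-- The hyperedges as a finset of finsets. -/
noncomputable def edgeFinset (H : Hypergraph V) : Finset (Finset V) :=
  Finset.univ.filter fun e => (e : Set V) ∈ E(H)

theorem mem_edgeFinset {H : Hypergraph V} {e : Finset V} :
    e ∈ edgeFinset H ↔ (e : Set V) ∈ E(H) := by
  simp [edgeFinset]

theorem isProper_iff {H : Hypergraph V} {C : Type*} {X : V → C} :
    H.IsProper X ↔ ∀ e ∈ edgeFinset H, ¬ Mono X e := by
  constructor
  · intro h e he hm
    exact h e (mem_edgeFinset.1 he) (by simpa [Mono] using hm)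
  · intro h e he hm
    obtain ⟨f, rfl⟩ : ∃ f : Finset V, (f : Set V) = e := ⟨e.toFinite.toFinset, by simp⟩
    exact h f (mem_edgeFinset.2 he) (by simpa [Mono] using hm)

theorem card_filter_edgeFinset (H : Hypergraph V) (v : V) :
    ((edgeFinset H).filter fun e => v ∈ e).card = H.degree v := by
  rw [Hypergraph.degree, ← Set.ncard_coe_finset,
    ← Set.ncard_image_of_injective _ Finset.coe_injective]
  congr 1
  ext e
  simp only [Set.mem_image, Finset.mem_coe, Finset.mem_filter, mem_edgeFinset]
  constructor
  · rintro ⟨f, ⟨h1, h2⟩, rfl⟩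
    exact ⟨h1, by simpa using h2⟩
  · rintro ⟨h1, h2⟩
    exact ⟨e.toFinite.toFinset, by simpa using ⟨h1, h2⟩, by simp⟩

variable {H : Hypergraph V} {q s : ℕ} {h : Fin q → Fin s}

/-- The colours available at the vertices when all buckets are prescribed. -/
def bucketLists (h : Fin q → Fin s) (Y : V → Fin s) (w : V) : Finset (Fin q) :=
  Finset.univ.filter fun i => h i = Y w

open Classical in
theorem projectedDist_eq (Y : V → Fin s) :
    projectedDist H h Y = ((listColourings (edgeFinset H) (bucketLists h Y)).card : ℝ) /
      ((Finset.univ.filter fun Z : V → Fin q => H.IsProper Z).card : ℝ) := by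
  have h1 : listColourings (edgeFinset H) (bucketLists h Y) =
      (Finset.univ.filter fun X : V → Fin q => (fun v => h (X v)) = Y ∧ H.IsProper X) := by
    ext X
    simp [mem_listColourings, bucketLists, isProper_iff, funext_iff]
  rw [h1, projectedDist]
  simp only [colouringDist]
  simp only [← ite_and]
  rw [← Finset.sum_filter, Finset.sum_const, nsmul_eq_mul, mul_one_div]

theorem listColourings_update (Y : V → Fin s) (v : V) (c : Fin s) :
    listColourings (edgeFinset H) (bucketLists h (Function.update Y v c)) =
      (listColourings (edgeFinset H)
        (Function.update (bucketLists h Y) v Finset.univ)).filter fun X => h (X v) = c := by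
  ext X
  simp only [mem_listColourings, Finset.mem_filter]
  have : (∀ w, X w ∈ bucketLists h (Function.update Y v c) w) ↔
      (∀ w, X w ∈ Function.update (bucketLists h Y) v Finset.univ w) ∧ h (X v) = c := by
    constructor
    · intro hX
      refine ⟨fun w => ?_, by simpa [bucketLists] using hX v⟩
      by_cases hw : w = v
      · subst hw; simp
      · simpa [bucketLists, hw] using hX w
    · rintro ⟨hX, hv⟩ w
      by_cases hw : w = v
      · subst hw; simpa [bucketLists] using hv
      · simpa [bucketLists, hw] using hX w
  rw [this]
  tauto

/-- Forgetting the bucket of `v` frees its list to all colours; the normalising constant cancels.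
The dependence on the bucket of another vertex is thus through one list only. -/
theorem condMarginal_projectedDist (hZ : ∃ X : V → Fin q, H.IsProper X) (Y : V → Fin s) (v : V)
    (c : Fin s) :
    condMarginal (projectedDist H h) v Y c =
      (((listColourings (edgeFinset H)
        (Function.update (bucketLists h Y) v Finset.univ)).filter fun X => h (X v) = c).card : ℝ) /
      (listColourings (edgeFinset H) (Function.update (bucketLists h Y) v Finset.univ)).card := by
  classical
  have hZ' : ((Finset.univ.filter fun Z : V → Fin q => H.IsProper Z).card : ℝ) ≠ 0 := by
    obtain ⟨X, hX⟩ := hZ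
    exact Nat.cast_ne_zero.2 (Finset.card_ne_zero.2 ⟨X, by simpa using hX⟩)
  simp only [condMarginal, projectedDist_eq, listColourings_update]
  rw [← Finset.sum_div, div_div_div_cancel_right₀ hZ', ← Nat.cast_sum]
  congr 2
  exact (Finset.card_eq_sum_card_fiberwise
    (fun x _ => Finset.mem_coe.2 (Finset.mem_univ (h (x v))))).symm

theorem sum_projectedDist (hZ : ∃ X : V → Fin q, H.IsProper X) :
    ∑ Y, projectedDist H h Y = 1 := by
  classical
  simp only [projectedDist]
  rw [Finset.sum_comm]
  simp only [Finset.sum_ite_eq, Finset.mem_univ, if_true]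
  simp only [colouringDist]
  rw [← Finset.sum_filter, Finset.sum_const, nsmul_eq_mul, mul_one_div, div_self]
  obtain ⟨X, hX⟩ := hZ
  exact Nat.cast_ne_zero.2 (Finset.card_ne_zero.2 ⟨X, by simpa using hX⟩)

end Projection

/-! ### Every window of `n` steps visits each vertex exactly once -/

section Labels

variable {V : Type*} {n : ℕ} [NeZero n] (label : V ≃ Fin n)

/-- The vertex updated in step `t`. -/
def scanVertex (t : ℕ) : V := label.symm ⟨t % n, Nat.mod_lt t (NeZero.pos n)⟩

theorem scanVertex_injOn (r : ℕ) : Set.InjOn (scanVertex label) (Set.Ioc r (r + n)) := by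
  intro i hi j hj hij
  have h1 : i % n = j % n := Fin.mk.inj_iff.1 (label.symm.injective hij)
  refine Nat.ModEq.eq_of_abs_lt h1 ?_
  have := hi.1; have := hi.2; have := hj.1; have := hj.2
  rw [abs_lt]
  constructor <;> omega

theorem scanVertex_surj (r : ℕ) (u : V) : ∃ i ∈ Set.Ioc r (r + n), scanVertex label i = u := by
  have : Finite V := Finite.of_equiv _ label.symm
  have hmem : ∀ i : Fin n, r + 1 + i ∈ Set.Ioc r (r + n) := fun i => ⟨by omega, by omega⟩
  have hinj : Function.Injective fun i : Fin n => label (scanVertex label (r + 1 + i)) := by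
    intro i j hij
    have := scanVertex_injOn label r (hmem i) (hmem j) (label.injective hij)
    exact Fin.ext (by omega)
  obtain ⟨i, hi⟩ := Finite.surjective_of_injective hinj (label u)
  exact ⟨_, hmem i, label.injective hi⟩

end Labels

/-! ### Row sums of the influence matrix -/

section Influence

variable {V : Type*} [Fintype V] [DecidableEq V] {H : Hypergraph V} {k Δ q s : ℕ}
  {h : Fin q → Fin s} {β : ℝ}

/-- The Dobrushin influence matrix of the projected distribution has small row sums. -/
theorem exists_influence (hq : 0 < q) (hk : 2 ≤ k)
    (hsimple : H.IsSimple) (hunif : H.IsUniform k) (hdeg : ∀ v, H.degree v ≤ Δ)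
    (hβ : 0 < β) (hL : ∀ j, β + Δ / β ^ (k - 2) ≤ ((Finset.univ.filter fun i => h i = j).card : ℝ))
    (hγ : Δ * (k * (q * (2 / β) ^ (k - 1))) ≤ (1 / 5 : ℝ)) :
    (∑ τ, projectedDist H h τ = 1 ∧ ∀ τ, 0 < projectedDist H h τ) ∧
    ∃ R : V → V → ℝ, (∀ v u, 0 ≤ R v u) ∧ (∀ v, ∑ u, R v u ≤ 1 / 2) ∧
      ∀ v u, u ≠ v → ∀ X Y : V → Fin s, (∀ w, w ≠ u → X w = Y w) →
        ∑ c, |condMarginal (projectedDist H h) v X c -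
          condMarginal (projectedDist H h) v Y c| ≤ R v u := by
  have : Nonempty (Fin q) := ⟨⟨0, hq⟩⟩
  have hunif' : ∀ e ∈ edgeFinset H, e.card = k := fun e he => by
    rw [← hunif _ (mem_edgeFinset.1 he), Set.ncard_coe_finset]
  have hlin : ∀ e ∈ edgeFinset H, ∀ f ∈ edgeFinset H, e ≠ f → (e ∩ f).card ≤ 1 := by
    intro e he f hf hef
    have := hsimple _ (mem_edgeFinset.1 he) _ (mem_edgeFinset.1 hf)
      (fun h => hef (Finset.coe_injective h))
    rwa [← Finset.coe_inter, Set.ncard_coe_finset] at this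
  have hdeg' : ∀ v, ((edgeFinset H).filter fun e => v ∈ e).card ≤ Δ := fun v =>
    (card_filter_edgeFinset H v).trans_le (hdeg v)
  have hLY : ∀ (Y : V → Fin s) (w : V), β + Δ / β ^ (k - 2) ≤ ((bucketLists h Y w).card : ℝ) :=
    fun Y w => hL (Y w)
  have hLv : ∀ (Y : V → Fin s) (v w : V), β + Δ / β ^ (k - 2) ≤
      ((Function.update (bucketLists h Y) v Finset.univ w).card : ℝ) := by
    intro Y v w
    refine (hLY Y w).trans (Nat.cast_le.2 (Finset.card_le_card ?_))
    by_cases hw : w = v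
    · subst hw; simp
    · simp [hw]
  have hlists : ∀ L : V → Finset (Fin q), (∀ w, β + Δ / β ^ (k - 2) ≤ ((L w).card : ℝ)) →
      (listColourings (edgeFinset H) L).Nonempty := fun L hL' =>
    listColourings_nonempty hk hunif' hdeg' hβ hL'
  have hZ : ∀ Y : V → Fin s, ∃ X ∈ listColourings (edgeFinset H) (bucketLists h Y),
      H.IsProper X := by
    intro Y
    obtain ⟨X, hX⟩ := hlists _ (hLY Y)
    exact ⟨X, hX, isProper_iff.2 (mem_listColourings.1 hX).2⟩
  have hZ' : ∃ X : V → Fin q, H.IsProper X :=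
    (hZ fun _ => h ⟨0, hq⟩).imp fun _ => And.right
  refine ⟨⟨sum_projectedDist hZ', fun τ => ?_⟩, ?_⟩
  · classical
    rw [projectedDist_eq]
    obtain ⟨X, hX⟩ := hZ'
    exact div_pos (Nat.cast_pos.2 (hlists _ (hLY τ)).card_pos)
      (Nat.cast_pos.2 (Finset.card_pos.2 ⟨X, by simpa using hX⟩))
  set ρ : ℝ := Fintype.card (Fin q) * (2 / β) ^ (k - 1) with hρ
  have hρ0 : 0 ≤ ρ := by positivity
  have hγ' : Δ * (k * ρ) ≤ (1 / 5 : ℝ) := by rwa [hρ, Fintype.card_fin]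
  obtain ⟨N, hN⟩ := exists_reach_bound (C := Fin q) (edgeFinset H)
  -- Chains start at length 1: the empty chain matters only for `u = v` and would add 1 to the
  -- series. The row sum is then at most 2·(1/4).
  refine ⟨fun v u => 2 * ∑ n ∈ Finset.range N, pathWeight (edgeFinset H) ρ u (n + 1) v,
    fun v u => mul_nonneg (by norm_num)
      (Finset.sum_nonneg fun n _ => pathWeight_nonneg hρ0 _ _), fun v => ?_, ?_⟩
  · rw [← Finset.mul_sum, Finset.sum_comm]
    have h1 := Finset.sum_le_sum fun n (_ : n ∈ Finset.range N) =>
      sum_pathWeight_le hunif' hdeg' hρ0 (n + 1) v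
    have h2 := sum_pow_succ_le (by positivity) hγ' N
    linarith
  · intro v u huv X Y hXY
    simp only [condMarginal_projectedDist hZ']
    have hLL : ∀ w, w ≠ u → Function.update (bucketLists h X) v Finset.univ w =
        Function.update (bucketLists h Y) v Finset.univ w := by
      intro w hw
      by_cases hwv : w = v
      · subst hwv; simp
      · simp [hwv, bucketLists, hXY w hw]
    have hA := hlists _ (hLv X v)
    have hA' := hlists _ (hLv Y v)
    have h1 := sum_abs_marginal_le h hLL hA hA' v
    have h2 := card_conn_le hk hunif' hlin hdeg' hβ (hLv X v) (hLv Y v) hN u v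
    have h3 : ∑ n ∈ Finset.range N, pathWeight (edgeFinset H) ρ u n v ≤
        ∑ n ∈ Finset.range N, pathWeight (edgeFinset H) ρ u (n + 1) v := by
      have h4 := Finset.sum_range_succ' (fun n => pathWeight (edgeFinset H) ρ u n v) N
      have h5 := Finset.sum_range_succ (fun n => pathWeight (edgeFinset H) ρ u n v) N
      have h6 : pathWeight (edgeFinset H) ρ u 0 v = 0 := by simp [pathWeight, huv.symm]
      have h7 := pathWeight_nonneg (E := edgeFinset H) (u := u) hρ0 N v
      linarith
    refine le_trans (le_trans (le_of_eq ?_) h1)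
      (mul_le_mul_of_nonneg_left (le_trans ?_ h3) (by norm_num))
    · congr!
    · rw [div_le_iff₀ (mul_pos (Nat.cast_pos.2 hA.card_pos) (Nat.cast_pos.2 hA'.card_pos))]
      convert h2

end Influence

end BucketScan

/-- Irreducibility, aperiodicity, reversibility and the mixing time bound for the idealised
systematic scan on bucket assignments. -/
theorem mainTheorem3 {V : Type*} [Fintype V] [DecidableEq V]
    (n k Δ q : ℕ) [NeZero n]
    (label : V ≃ Fin n)
    (H : Hypergraph V) (hV : H.vertexSet = Set.univ)
    (hsimple : H.IsSimple) (hunif : H.IsUniform k)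
    (hΔ : H.maxDegree = Δ) (hΔ1 : 1 ≤ Δ)
    (hk : 20 ≤ k)
    (hq : 40 * (Δ : ℝ) ^ ((2 : ℝ) / ((k : ℝ) - 4)) ≤ (q : ℝ))
    (h : Fin q → Fin (BucketScan.numBuckets q)) (hbal : BucketScan.IsBalanced h) :
    -- the projected distribution is a probability distribution with full support
    (∑ τ, BucketScan.projectedDist H h τ = 1 ∧ ∀ τ, 0 < BucketScan.projectedDist H h τ) ∧
    -- irreducible, aperiodic, reversible
    BucketScan.IsIrreducible
      (BucketScan.systematicScan (BucketScan.projectedDist H h) label) ∧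
    BucketScan.IsAperiodic
      (BucketScan.systematicScan (BucketScan.projectedDist H h) label) ∧
    BucketScan.IsReversible
      (BucketScan.systematicScan (BucketScan.projectedDist H h) label)
      (BucketScan.projectedDist H h) ∧
    -- the time-homogeneous chain of full sweeps is irreducible and aperiodic as well
    BucketScan.IsIrreducible (fun _ => BucketScan.multiStep
      (BucketScan.systematicScan (BucketScan.projectedDist H h) label) 0 n) ∧
    BucketScan.IsAperiodic (fun _ => BucketScan.multiStep
      (BucketScan.systematicScan (BucketScan.projectedDist H h) label) 0 n) ∧
    -- mixing time, counted in single-vertex updates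
    ∀ ε : ℝ, 0 < ε → ε < 1 →
      BucketScan.mixingTime
          (BucketScan.systematicScan (BucketScan.projectedDist H h) label)
          (BucketScan.projectedDist H h) ε ≤
        ((⌈50 * (n : ℝ) * Real.log ((n : ℝ) * (Δ : ℝ) / ε)⌉₊ : ℕ) : ℕ∞) := by
  obtain ⟨hq40, β, hβ, hβL, hγ⟩ := BucketScan.numerical_bounds hΔ1 hk hq
  have hdeg : ∀ v, H.degree v ≤ Δ := fun v => hΔ ▸ Finset.le_sup (f := H.degree) (Finset.mem_univ v)
  have hcard : Fintype.card V = n := by rw [Fintype.card_congr label, Fintype.card_fin]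
  -- A positive maximum degree provides an edge, which has `k ≥ 20` vertices.
  have hn : 2 ≤ n := by
    have h1 : 0 < H.maxDegree := hΔ ▸ hΔ1
    obtain ⟨v, -, hv⟩ := Finset.lt_sup_iff.1 h1
    obtain ⟨e, he, -⟩ := Set.nonempty_of_ncard_ne_zero hv.ne'
    have h2 := Set.ncard_le_card e
    rw [hunif e he, Nat.card_eq_fintype_card, hcard] at h2
    omega
  have hL : ∀ j, β + Δ / β ^ (k - 2) ≤ ((Finset.univ.filter fun i => h i = j).card : ℝ) := by
    intro j
    refine hβL.trans (Nat.cast_le.2 ?_)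
    rcases hbal j with h1 | h1
    · exact h1.ge
    · exact (Nat.floor_le_ceil _).trans h1.ge
  obtain ⟨⟨hsum, hpos⟩, R, hR0, hRs, hR⟩ :=
    BucketScan.exists_influence (h := h) (by omega) (by omega) hsimple hunif hdeg hβ hL hγ
  have hscan : BucketScan.systematicScan (BucketScan.projectedDist H h) label = fun t =>
      BucketScan.heatBath (BucketScan.projectedDist H h) (BucketScan.scanVertex label t) := rfl
  have hsweep := BucketScan.multiStep_pos hpos (BucketScan.scanVertex_surj label)
  rw [hscan]
  refine ⟨⟨hsum, hpos⟩, fun r X Y => ⟨n, NeZero.pos n, hsweep r X Y⟩,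
    BucketScan.isAperiodic_of_pos fun t X => BucketScan.heatBath_pos hpos fun _ _ => rfl,
    fun t _ X Y => BucketScan.heatBath_reversible _ X Y,
    fun r X Y => ⟨1, one_pos, by rw [BucketScan.multiStep_one]; exact hsweep 0 X Y⟩,
    BucketScan.isAperiodic_of_pos fun t X => hsweep 0 X X, fun ε hε hε1 => ?_⟩
  refine iInf₂_le_of_le _ (fun X => ?_) le_rfl
  set T := ⌈50 * (n : ℝ) * Real.log ((n : ℝ) * (Δ : ℝ) / ε)⌉₊
  refine lt_of_le_of_lt ?_ (BucketScan.sweeps_suffice hn hΔ1 hε hε1)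
  refine BucketScan.tvDist_le_of_hasOsc hpos hsum
    (BucketScan.vecMul_multiStep (fun t => BucketScan.vecMul_heatBath hpos _) 0 T)
    (fun f hf => ?_) X
  -- Split `T` into `T % n` initial steps and `T / n` full sweeps; the initial total oscillation is
  -- `n`.
  obtain ⟨d, hd, hle⟩ := BucketScan.HasOsc.multiStep_sweeps hpos hR hR0 hRs
    (BucketScan.scanVertex_injOn label) (BucketScan.scanVertex_surj label)
    (Nat.mod_lt T (NeZero.pos n)).le (T / n) (fun _ => zero_le_one) hf
  rw [mul_comm (T / n) n, Nat.mod_add_div] at hd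
  refine ⟨d, hd, ?_⟩
  rw [le_div_iff₀ (by positivity), mul_comm]
  simpa [hcard] using hle
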